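/- Let $n\ge 2$ and let $\Lambda=\mathbb Z^n$ with the lexicographic order, $\Lambda^+=\{a\in\Lambda: a>0\}$. Let $\partial\Lambda^+$ be the set of all $b=(k_1,\dots,k_{n-1},\infty)$ with $k_i\in\mathbb Z\cup\{\infty\}$, $k_i=\infty\Rightarrow k_{i+1}=\infty$, and $b>0$ lexicographically (i.e. the first non-zero entry of $b$ is positive). Take two copies $G_1,G_2$ of $\Lambda^+$ and correspondingly two copies $\partial G_1,\partial G_2$ of $\partial\Lambda^+$. Let $X=G_1*G_2$ be the set of finite words $a_1\cdots a_d$ ($d\ge 0$) whose letters lie alternately in $G_1$ and $G_2$, and let $\partial X$ be the set of all words $a_1\cdots a_d$ ($d\ge1$) with alternating indices, $a_i\in G_1\cup G_2$ for $i<d$ and $a_d\in\partial G_1\cup\partial G_2$, together with all infinite words $a_1a_2\cdots$ with letters alternately in $G_1$ and $G_2$. For $p\in X$ and $x\in\partial X$ let $px\in\partial X$ be the concatenation, where the last letter of $p$ and the first letter of $x$ are added (componentwise) if they have the same index. Let $l(p)\in\Lambda$ be the sum of the letters of $p$. Put $V(p)=\{px:x\in\partial X\}$ and $\mathcal E=\{V(p):p\in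 X\}\cup\{V(p)\setminus V(q):p,q\in X\}$. Let $\mathcal G$ be the groupoid of all $(x,k,y)\in\partial X\times\Lambda\times\partial X$ for which there are $p,q\in X$, $z\in\partial X$ with $k=l(p)-l(q)$, $x=pz$, $y=qz$, with $(x,k,y)(y,m,z)=(x,k+m,z)$ and $(x,k,y)^{-1}=(y,-k,x)$, and with the topology generated by the sets $[p,q]_S=\{(px,l(p)-l(q),qx):x\in S\}$, $p,q\in X$, $S\in\mathcal E$. Let $A=C^*(\mathcal G)$ be its (full) groupoid $C^*$-algebra, i.e. the completion of the convolution $*$-algebra $C_c(\mathcal G)$ in the supremum of the seminorms $\|\pi(\cdot)\|$ over all $*$-representations $\pi$ on Hilbert spaces that are bounded by the $I$-norm $\|f\|_I=\max\bigl(\sup_x\sum_{r(\gamma)=x}|f(\gamma)|,\ \sup_x\sum_{s(\gamma)=x}|f(\gamma)|\bigr)$. Let $\hat\Lambda$ be the (compact) dual group of the discrete group $\Lambda$, and let $\alpha:\hat\Lambda\to\operatorname{Aut}(A)$ be the gauge action, the continuous extension of $\alpha_t(f)(x,k,y)=\langle k,t\rangle f(x,k,y)$, $f\in C_c(\mathcal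 G)$. Let $A\times_\alpha\hat\Lambda$ be the crossed product, i.e. the enveloping $C^*$-algebra (with respect to $L^1$-bounded $*$-representations on Hilbert spaces) of $C(\hat\Lambda,A)$ with $(f\cdot g)(s)=\int_{\hat\Lambda} f(t)\,\alpha_t(g(t^{-1}s))\,dt$ and $f^*(s)=\alpha_s(f(s^{-1})^*)$, where $dt$ is normalized Haar measure. **Theorem.** $A\times_\alpha\hat\Lambda$ is an AF algebra, that is, it is the closure of the union of an increasing sequence of finite-dimensional $C^*$-subalgebras. -/

import Mathlib

open scoped ENNReal CompactlySupported

noncomputable section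

/-! ### C*-algebras generated by all bounded representations of a convolution algebra -/

/-- The data of a convolution algebra on a complex vector space `V` that enter the definition of its
enveloping C*-algebra: `IsMul f g h` says that `h` is the product of `f` and `g`, `IsStar f h` says
that `h` is the adjoint of `f`, and `bound` is the norm by which representations are bounded. -/
structure ConvolutionData (V : Type*) where
  IsMul : V → V → V → Prop
  IsStar : V → V → Prop
  bound : V → ℝ≥0∞

/-- A bounded `*`-representation on a Hilbert space. (The algebras to which this is applied are
separable in the norm `bound`, so that Hilbert spaces in the lowest universe yield all C*-seminorms;
`IsMul f g` and `IsStar f` are the graphs of the product and of the adjoint.) -/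
structure BoundedRep {V : Type*} [AddCommGroup V] [Module ℂ V] (D : ConvolutionData V) where
  H : Type
  [normedAddCommGroup : NormedAddCommGroup H]
  [innerProductSpace : InnerProductSpace ℂ H]
  [completeSpace : CompleteSpace H]
  toLin : V →ₗ[ℂ] (H →L[ℂ] H)
  map_mul : ∀ f g h, D.IsMul f g h → toLin h = toLin f * toLin g
  map_star : ∀ f h, D.IsStar f h → toLin h = star (toLin f)
  le_bound : ∀ f, ‖toLin f‖ₑ ≤ D.bound f

attribute [instance] BoundedRep.normedAddCommGroup BoundedRep.innerProductSpace
  BoundedRep.completeSpace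

/-- The bounded families `(T π)` of operators, `π` running through all bounded representations;
this is the C*-algebra of "diagonal" operators on the direct sum of all of them. -/
abbrev RepFamily {V : Type*} [AddCommGroup V] [Module ℂ V] (D : ConvolutionData V) :=
  lp (fun π : BoundedRep D => π.H →L[ℂ] π.H) ∞

/-- The enveloping C*-algebra: the C*-algebra generated by the image of `V` in the direct sum of all
bounded representations. Equivalently, it is the (separated) completion of `V` in the C*-seminorm
`f ↦ sup_π ‖π f‖`. -/
def envelopingAlgebra {V : Type*} [AddCommGroup V] [Module ℂ V] (D : ConvolutionData V) :
    NonUnitalStarSubalgebra ℂ (RepFamily D) :=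
  (NonUnitalStarAlgebra.adjoin ℂ
    {F : RepFamily D | ∃ f : V, ∀ π : BoundedRep D, F π = π.toLin f}).topologicalClosure

/-- The enveloping C*-algebra as a type. -/
def Enveloping {V : Type*} [AddCommGroup V] [Module ℂ V] (D : ConvolutionData V) : Type _ :=
  ↥(envelopingAlgebra D)

instance {V : Type*} [AddCommGroup V] [Module ℂ V] (D : ConvolutionData V) :
    NonUnitalCStarAlgebra (Enveloping D) :=
  NonUnitalStarSubalgebra.nonUnitalCStarAlgebra (envelopingAlgebra D)
    (h_closed := NonUnitalStarSubalgebra.isClosed_topologicalClosure _)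

/-- An endomorphism of a convolution algebra. -/
structure ConvolutionData.Endo {V : Type*} [AddCommGroup V] [Module ℂ V]
    (D : ConvolutionData V) where
  toLin : V →ₗ[ℂ] V
  map_mul : ∀ f g h, D.IsMul f g h → D.IsMul (toLin f) (toLin g) (toLin h)
  map_star : ∀ f h, D.IsStar f h → D.IsStar (toLin f) (toLin h)
  bound_le : ∀ f, D.bound (toLin f) ≤ D.bound f

namespace ConvolutionData.Endo

variable {V : Type*} [AddCommGroup V] [Module ℂ V] {D : ConvolutionData V}

/-- The representation `π ∘ φ`. -/
def pullRep (φ : D.Endo) (π : BoundedRep D) : BoundedRep D where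
  H := π.H
  toLin := π.toLin ∘ₗ φ.toLin
  map_mul f g h hm := π.map_mul _ _ _ (φ.map_mul f g h hm)
  map_star f h hs := π.map_star _ _ (φ.map_star f h hs)
  le_bound f := (π.le_bound _).trans (φ.bound_le f)

/-- The `*`-homomorphism `(T π) ↦ (T (π ∘ φ))`; it sends the image of `f` to the image of `φ f`. -/
def onFamilies (φ : D.Endo) : RepFamily D →⋆ₙₐ[ℂ] RepFamily D where
  toFun F := ⟨fun π => (F (φ.pullRep π) : π.H →L[ℂ] π.H), by
    refine memℓp_infty ⟨‖F‖, ?_⟩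
    rintro _ ⟨π, rfl⟩
    exact lp.norm_apply_le_norm ENNReal.top_ne_zero F (φ.pullRep π)⟩
  map_smul' _ _ := rfl
  map_zero' := rfl
  map_add' _ _ := rfl
  map_mul' _ _ := rfl
  map_star' _ := rfl

theorem onFamilies_mem (φ : D.Endo) (F : RepFamily D) (hF : F ∈ envelopingAlgebra D) :
    φ.onFamilies F ∈ envelopingAlgebra D := by
  have hle : envelopingAlgebra D ≤ (envelopingAlgebra D).comap φ.onFamilies := by
    refine NonUnitalStarSubalgebra.topologicalClosure_minimal _ ?_ ?_
    · refine NonUnitalStarAlgebra.adjoin_le ?_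
      rintro G ⟨f, hf⟩
      refine NonUnitalStarSubalgebra.le_topologicalClosure _
        (NonUnitalStarAlgebra.subset_adjoin ℂ _ ⟨φ.toLin f, fun π => hf (φ.pullRep π)⟩)
    · have hc : Continuous φ.onFamilies := by
        refine AddMonoidHomClass.continuous_of_bound φ.onFamilies 1 fun G => ?_
        rw [one_mul]
        refine lp.norm_le_of_forall_le (norm_nonneg G) fun π => ?_
        exact lp.norm_apply_le_norm ENNReal.top_ne_zero G (φ.pullRep π)
      exact (NonUnitalStarSubalgebra.isClosed_topologicalClosure _).preimage hc
  exact hle hF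

/-- The continuous extension of an endomorphism `φ` to the enveloping C*-algebra. -/
def extend (φ : D.Endo) : Enveloping D →⋆ₙₐ[ℂ] Enveloping D :=
  NonUnitalStarAlgHom.codRestrict
    (φ.onFamilies.comp (NonUnitalStarSubalgebraClass.subtype (envelopingAlgebra D)))
    (envelopingAlgebra D) fun F => φ.onFamilies_mem F F.2

end ConvolutionData.Endo

/-! ### Crossed products by compact groups, AF algebras -/

/-- Normalized Haar measure of a compact group, on its Borel sets. -/
def normalizedHaar (K : Type*) [Group K] [TopologicalSpace K] [IsTopologicalGroup K]
    [CompactSpace K] : @MeasureTheory.Measure K (borel K) :=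
  letI := borel K
  haveI : BorelSpace K := ⟨rfl⟩
  MeasureTheory.Measure.haarMeasure ⊤

/-- The convolution algebra `C(K, A)` of an action `α` of a compact group `K` on `A`, with
`(f g)(s) = ∫ f(t) α_t(g(t⁻¹ s)) dt`, `f^*(s) = α_s(f(s⁻¹)^*)` and the `L¹`-norm. -/
def crossedProductData {K A : Type*} [Group K] [TopologicalSpace K] [IsTopologicalGroup K]
    [CompactSpace K] [NonUnitalCStarAlgebra A] (α : K → A →⋆ₙₐ[ℂ] A) :
    ConvolutionData C(K, A) where
  IsMul f g h := ∀ s,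
    h s = @MeasureTheory.integral K A _ _ (borel K) (normalizedHaar K)
      fun t => f t * α t (g (t⁻¹ * s))
  IsStar f h := ∀ s, h s = α s (star (f s⁻¹))
  bound f := @MeasureTheory.lintegral K (borel K) (normalizedHaar K) fun t => ‖f t‖ₑ

/-- The crossed product of `A` by the action `α` of the compact group `K`. -/
abbrev CrossedProduct {K A : Type*} [Group K] [TopologicalSpace K] [IsTopologicalGroup K]
    [CompactSpace K] [NonUnitalCStarAlgebra A] (α : K → A →⋆ₙₐ[ℂ] A) :=
  Enveloping (crossedProductData α)

/-- A C*-algebra is AF if it is the closure of the union of an increasing sequence of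
finite-dimensional C*-subalgebras. -/
def IsAF (A : Type*) [NonUnitalCStarAlgebra A] : Prop :=
  ∃ S : ℕ → NonUnitalStarSubalgebra ℂ A,
    Monotone S ∧ (∀ k, FiniteDimensional ℂ (S k)) ∧ Dense (⋃ k, (S k : Set A))

/-! ### The tree of `ℤⁿ` and its boundary -/

namespace ZnTree

/-- `Λ = ℤⁿ` with the lexicographic order. -/
abbrev Lam (n : ℕ) := Lex (Fin n → ℤ)

/-- A letter: an element of one of two copies of `Λ`; the Boolean is the index of the copy. -/
abbrev Letter (n : ℕ) := Bool × Lam n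

/-- The positive elements `(k₁, …, k_{n-1}, ∞)`, `k_i ∈ ℤ ∪ {∞}`, in which all entries after an
infinite one are infinite: these form `∂Λ⁺`. -/
def IsBoundaryPos {n : ℕ} (b : Fin n → WithTop ℤ) : Prop :=
  (∀ i : Fin n, (i : ℕ) + 1 = n → b i = ⊤) ∧ (∀ i j : Fin n, i ≤ j → b i = ⊤ → b j = ⊤) ∧
    (0 : Lex (Fin n → WithTop ℤ)) < toLex b

/-- The tree `X = Λ⁺ * Λ⁺`: words in positive letters with alternating indices. -/
structure Vertex (n : ℕ) where
  letters : List (Letter n)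
  pos : ∀ a ∈ letters, 0 < a.2
  alternating : letters.IsChain fun a b => a.1 ≠ b.1

/-- The length `l(p) ∈ Λ`. -/
def Vertex.length {n : ℕ} (p : Vertex n) : Lam n := (p.letters.map Prod.snd).sum

/-- `finite w i b` is the finite word `w b`, with `b` in the copy `i` of `∂Λ⁺`; `infinite a` is the
infinite word `a₀ a₁ a₂ …`. -/
inductive PreEnd (n : ℕ)
  | finite (w : List (Letter n)) (i : Bool) (b : Fin n → WithTop ℤ)
  | infinite (a : ℕ → Letter n)

/-- The words that are elements of `∂X`. -/
def PreEnd.IsEnd {n : ℕ} : PreEnd n → Prop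
  | finite w i b => (∀ a ∈ w, 0 < a.2) ∧ (w.map Prod.fst ++ [i]).IsChain (· ≠ ·) ∧ IsBoundaryPos b
  | infinite a => (∀ k, 0 < (a k).2) ∧ ∀ k, (a k).1 ≠ (a (k + 1)).1

/-- Concatenation of a letter and a word; the letter is added to the first letter of the word if
the indices agree. -/
def PreEnd.cons {n : ℕ} (c : Letter n) : PreEnd n → PreEnd n
  | finite [] i b => if c.1 = i then finite [] i (fun j => ((c.2 j : ℤ) : WithTop ℤ) + b j)
      else finite [c] i b
  | finite (d :: w) i b => if c.1 = d.1 then finite ((d.1, c.2 + d.2) :: w) i b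
      else finite (c :: d :: w) i b
  | infinite a => if c.1 = (a 0).1 then infinite (fun k => Nat.casesOn k ((a 0).1, c.2 + (a 0).2)
      fun m => a (m + 1))
      else infinite (fun k => Nat.casesOn k c a)

theorem IsBoundaryPos.add {n : ℕ} {c : Lam n} (hc : 0 < c) {b : Fin n → WithTop ℤ}
    (hb : IsBoundaryPos b) : IsBoundaryPos fun j => ((c j : ℤ) : WithTop ℤ) + b j := by
  obtain ⟨h1, h2, i, hi, hi'⟩ := hb
  obtain ⟨k, hk, hk'⟩ := hc
  refine ⟨fun j hj => by simp [h1 j hj], fun j m hjm hj => ?_, ?_⟩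
  · have : b j = ⊤ := by simpa using hj
    simp [h2 j m hjm this]
  · have hi2 : ∀ j < i, b j = 0 := fun j hj => (hi j hj).symm
    have hk2 : ∀ j < k, c j = 0 := fun j hj => (hk j hj).symm
    have hi3 : 0 < b i := hi'
    have hk3 : 0 < c k := hk'
    have hk4 : (0 : WithTop ℤ) < ((c k : ℤ) : WithTop ℤ) := by exact_mod_cast hk3
    rcases lt_trichotomy i k with h | h | h
    · refine ⟨i, fun j hj => ?_, ?_⟩
      · change (0 : WithTop ℤ) = ((c j : ℤ) : WithTop ℤ) + b j
        simp [hi2 j hj, hk2 j (hj.trans h)]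
      · change (0 : WithTop ℤ) < ((c i : ℤ) : WithTop ℤ) + b i
        simpa [hk2 i h] using hi3
    · subst h
      refine ⟨i, fun j hj => ?_, ?_⟩
      · change (0 : WithTop ℤ) = ((c j : ℤ) : WithTop ℤ) + b j
        simp [hi2 j hj, hk2 j hj]
      · change (0 : WithTop ℤ) < ((c i : ℤ) : WithTop ℤ) + b i
        exact hk4.trans_le (le_add_of_nonneg_right hi3.le)
    · refine ⟨k, fun j hj => ?_, ?_⟩
      · change (0 : WithTop ℤ) = ((c j : ℤ) : WithTop ℤ) + b j
        simp [hi2 j (hj.trans h), hk2 j hj]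
      · change (0 : WithTop ℤ) < ((c k : ℤ) : WithTop ℤ) + b k
        simpa [hi2 k h] using hk3

theorem PreEnd.IsEnd.cons {n : ℕ} {c : Letter n} (hc : 0 < c.2) :
    ∀ {x : PreEnd n}, x.IsEnd → (x.cons c).IsEnd
  | finite [] i b, ⟨h1, h2, h3⟩ => by
    simp only [PreEnd.cons]
    split_ifs with h
    · exact ⟨h1, h2, h3.add hc⟩
    · exact ⟨by simpa using hc, by simpa using h, h3⟩
  | finite (d :: w) i b, ⟨h1, h2, h3⟩ => by
    simp only [PreEnd.cons]
    split_ifs with h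
    · refine ⟨?_, by simpa using h2, h3⟩
      intro a ha
      rcases List.mem_cons.1 ha with rfl | ha
      · exact add_pos hc (h1 d (by simp))
      · exact h1 a (by simp [ha])
    · refine ⟨?_, ?_, h3⟩
      · intro a ha
        rcases List.mem_cons.1 ha with rfl | ha
        · exact hc
        · exact h1 a ha
      · simpa [h] using h2
  | infinite a, ⟨h1, h2⟩ => by
    simp only [PreEnd.cons]
    split_ifs with h
    · refine ⟨fun k => ?_, fun k => ?_⟩
      · cases k with
        | zero => exact add_pos hc (h1 0)
        | succ k => exact h1 (k + 1)
      · cases k with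
        | zero => exact h2 0
        | succ k => exact h2 (k + 1)
    · refine ⟨fun k => ?_, fun k => ?_⟩
      · cases k with
        | zero => exact hc
        | succ k => exact h1 k
      · cases k with
        | zero => exact h
        | succ k => exact h2 k

/-- The boundary `∂X`. -/
def Boundary (n : ℕ) := {x : PreEnd n // x.IsEnd}

/-- Concatenation `p x` of a word `p ∈ X` and `x ∈ ∂X`. -/
def Vertex.concat {n : ℕ} (p : Vertex n) (x : Boundary n) : Boundary n :=
  ⟨p.letters.foldr PreEnd.cons x.1, by
    obtain ⟨w, hw, halt⟩ := p
    change (w.foldr PreEnd.cons x.1).IsEnd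
    clear halt
    induction w with
    | nil => exact x.2
    | cons c w ih => exact PreEnd.IsEnd.cons (hw c (by simp)) (ih fun a ha => hw a (by simp [ha]))⟩

/-- The set `V(p)` of all `p x`, `x ∈ ∂X`. -/
def cylinder {n : ℕ} (p : Vertex n) : Set (Boundary n) := Set.range p.concat

/-- The family of all sets `V(p)` and `V(p) \ V(q)`. -/
def basicSets (n : ℕ) : Set (Set (Boundary n)) :=
  {A | (∃ p, A = cylinder p) ∨ ∃ p q, A = cylinder p \ cylinder q}

/-! ### The groupoid and its C*-algebra -/

/-- `x ∼_k y`. -/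
def ShiftEquiv {n : ℕ} (k : Lam n) (x y : Boundary n) : Prop :=
  ∃ (p q : Vertex n) (z : Boundary n),
    k = p.length - q.length ∧ x = p.concat z ∧ y = q.concat z

/-- The groupoid `𝒢` of all `(x, k, y)` with `x ∼_k y`; here `x` is the range and `y` the source. -/
@[ext]
structure Arrow (n : ℕ) where
  range : Boundary n
  lag : Lam n
  source : Boundary n
  shiftEquiv : ShiftEquiv lag range source

/-- `c = a b` in the groupoid: `(x, k, y) (y, m, z) = (x, k + m, z)`. -/
def Arrow.IsProduct {n : ℕ} (a b c : Arrow n) : Prop :=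
  a.source = b.range ∧ c.range = a.range ∧ c.lag = a.lag + b.lag ∧ c.source = b.source

/-- The inverse `(y, -k, x)` of `(x, k, y)`. -/
def Arrow.inverse {n : ℕ} (a : Arrow n) : Arrow n where
  range := a.source
  lag := -a.lag
  source := a.range
  shiftEquiv := by
    obtain ⟨p, q, z, h, hx, hy⟩ := a.shiftEquiv
    exact ⟨q, p, z, by rw [h, neg_sub], hy, hx⟩

/-- The set `[p, q]_A` of all `(p x, l(p) - l(q), q x)`, `x ∈ A`. -/
def bisection {n : ℕ} (p q : Vertex n) (A : Set (Boundary n)) : Set (Arrow n) :=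
  {a | ∃ x ∈ A, a.range = p.concat x ∧ a.lag = p.length - q.length ∧ a.source = q.concat x}

/-- The topology with the sets `[p, q]_A`, `A` a basic set, as basic open sets. -/
instance (n : ℕ) : TopologicalSpace (Arrow n) :=
  TopologicalSpace.generateFrom {S | ∃ p q, ∃ A ∈ basicSets n, S = bisection p q A}

/-- The convolution algebra `C_c(𝒢)`, with `(f g)(c) = ∑_{c = a b} f(a) g(b)`,
`f^*(c) = conj (f(c⁻¹))`, and the norm
`max (sup_x ∑_{r(a) = x} |f(a)|) (sup_x ∑_{s(a) = x} |f(a)|)`. -/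
def groupoidData (n : ℕ) : ConvolutionData C_c(Arrow n, ℂ) where
  IsMul f g h := ∀ c : Arrow n,
    h c = ∑' ab : {ab : Arrow n × Arrow n // Arrow.IsProduct ab.1 ab.2 c}, f ab.1.1 * g ab.1.2
  IsStar f h := ∀ c : Arrow n, h c = star (f c.inverse)
  bound f := max (⨆ x : Boundary n, ∑' a : {a : Arrow n // a.range = x}, ‖f a.1‖ₑ)
    (⨆ x : Boundary n, ∑' a : {a : Arrow n // a.source = x}, ‖f a.1‖ₑ)

/-- The groupoid C*-algebra `A = C*(𝒢)`. -/
abbrev GroupoidCStar (n : ℕ) := Enveloping (groupoidData n)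

/-! ### The gauge action -/

/-- `Λ` carries the discrete topology. -/
instance (n : ℕ) : TopologicalSpace (Lam n) := ⊥

instance (n : ℕ) : DiscreteTopology (Lam n) := ⟨rfl⟩

/-- The dual group of `Λ`. -/
abbrev DualGroup (n : ℕ) := PontryaginDual (Multiplicative (Lam n))

/-- The value `⟨k, t⟩` of the character `t` at `k ∈ Λ`. -/
def pairing {n : ℕ} (k : Lam n) (t : DualGroup n) : ℂ := (t (Multiplicative.ofAdd k) : Circle)

theorem pairing_add {n : ℕ} (k m : Lam n) (t : DualGroup n) :
    pairing (k + m) t = pairing k t * pairing m t := by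
  simp [pairing, ofAdd_add]

theorem pairing_neg {n : ℕ} (k : Lam n) (t : DualGroup n) :
    pairing (-k) t = star (pairing k t) := by
  rw [pairing, pairing, ofAdd_neg, map_inv, Circle.coe_inv_eq_conj]
  rfl

theorem enorm_pairing {n : ℕ} (k : Lam n) (t : DualGroup n) : ‖pairing k t‖ₑ = 1 := by
  rw [pairing, ← ofReal_norm, Circle.norm_coe, ENNReal.ofReal_one]

theorem continuous_lag (n : ℕ) : Continuous (Arrow.lag : Arrow n → Lam n) := by
  refine continuous_discrete_rng.2 fun k => ?_
  have h : Arrow.lag ⁻¹' {k} = ⋃ (p : Vertex n) (q : Vertex n)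
      (_ : k = p.length - q.length), bisection p q (cylinder ⟨[], by simp, by simp⟩) := by
    ext a
    simp only [Set.mem_preimage, Set.mem_singleton_iff, Set.mem_iUnion, exists_prop]
    constructor
    · rintro rfl
      obtain ⟨p, q, z, h, hx, hy⟩ := a.shiftEquiv
      exact ⟨p, q, h, z, ⟨z, rfl⟩, hx, h, hy⟩
    · rintro ⟨p, q, h, x, -, -, hl, -⟩
      exact hl.trans h.symm
  rw [h]
  exact isOpen_iUnion fun p => isOpen_iUnion fun q => isOpen_iUnion fun _ =>
    TopologicalSpace.isOpen_generateFrom_of_mem ⟨p, q, _, Or.inl ⟨_, rfl⟩, rfl⟩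

/-- The gauge automorphism `α_t(f)(x, k, y) = ⟨k, t⟩ f(x, k, y)` of `C_c(𝒢)`. -/
def gaugeEndo (n : ℕ) (t : DualGroup n) : (groupoidData n).Endo where
  toLin :=
    { toFun f :=
        { toFun a := pairing a.lag t * f a
          continuous_toFun :=
            ((continuous_of_discreteTopology (f := fun k => pairing k t)).comp
              (continuous_lag n)).mul f.continuous
          hasCompactSupport' := f.hasCompactSupport.mul_left }
      map_add' f g := by ext a; exact mul_add _ _ _
      map_smul' c f := by ext a; exact mul_left_comm _ _ _ }
  map_mul f g h hm c := by
    change pairing c.lag t * h c = ∑' ab : {ab : Arrow n × Arrow n // Arrow.IsProduct ab.1 ab.2 c},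
      (pairing ab.1.1.lag t * f ab.1.1) * (pairing ab.1.2.lag t * g ab.1.2)
    rw [hm c, ← tsum_mul_left]
    refine tsum_congr fun ab => ?_
    rw [ab.2.2.2.1, pairing_add]
    ring
  map_star f h hs c := by
    change pairing c.lag t * h c = star (pairing (-c.lag) t * f c.inverse)
    rw [hs c, pairing_neg, star_mul', star_star]
  bound_le f := by
    change max (⨆ x : Boundary n, ∑' a : {a : Arrow n // a.range = x}, ‖pairing a.1.lag t * f a.1‖ₑ)
      (⨆ x : Boundary n, ∑' a : {a : Arrow n // a.source = x}, ‖pairing a.1.lag t * f a.1‖ₑ) ≤ _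
    simp only [enorm_mul, enorm_pairing, one_mul]
    exact le_rfl

/-- The gauge action `α` of the dual group of `Λ` on `C*(𝒢)`. -/
def gaugeAction (n : ℕ) (t : DualGroup n) : GroupoidCStar n →⋆ₙₐ[ℂ] GroupoidCStar n :=
  (gaugeEndo n t).extend

end ZnTree

end

/-! Write `1_[p,q]_S` for the characteristic function of the compact open bisection `[p, q]_S`, `S`
clopen in `∂X`. It is homogeneous of degree `l(p) - l(q)` under the gauge action. The crossed
product is the closed span of the elements `gen μ p q S`, the images of `t ↦ ⟨μ - l(q), t⟩
1_[p,q]_S`. This labelling makes the level `μ ∈ Λ` invariant under adjoints.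

Orthogonality of characters (`cross_mul`) makes `gen μ p q S * gen μ' p' q' S'` vanish unless `l(p')
- l(q) = μ' - μ`. Suppose `μ ≤ μ'` and the product is not zero. Then `l(q) ≤ l(p')`, and since words
with a common continuation are comparable, the shorter being a prefix of the longer
(`exists_isConcat_of_concat_eq`), `p' = q t`. The product is thus a generator of level `μ'`: the
larger level absorbs the smaller. Inside one level `l(q) = l(p')`, so either `q` and `p'` act
identically or the product is zero. Generators of one level therefore multiply like matrix units
times commuting projections, and finitely many of them generate a finite semigroup
(`finite_closure_of_subset_genSet`). As `Λ` is totally ordered, induction on the largest level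
extends this to finitely many generators of arbitrary levels (`finite_closure_of_graded`). Finite
semigroups span finite-dimensional algebras, and countability of the generators gives AF
(`isAF_of_finite_closure`).

What remains is density. The groupoid is covered by the open sets `[p, q]`, each homeomorphic to
`∂X`, so `∂X` has to be compact, Hausdorff and totally disconnected. Compactness is proved with
ultrafilters: from an ultrafilter one peels off letters, and either this stops at a letter of `∂Λ⁺`,
found as the supremum of a cut of `Λ⁺` (`exists_boundary_of_cut`), or it produces an infinite word
(`exists_sameCylinders_pure`). Separation says that an end is determined by the sets `V(p)`
containing it (`SameEnd.eq`). -/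

open scoped ENNReal CompactlySupported

noncomputable section

namespace ZnTree

variable {n : ℕ}

/-! ### Concatenation -/

/-- The index of the first letter. -/
def PreEnd.index : PreEnd n → Bool
  | finite [] i _ => i
  | finite (d :: _) _ _ => d.1
  | infinite a => (a 0).1

theorem PreEnd.index_cons (c : Letter n) (x : PreEnd n) : (x.cons c).index = c.1 := by
  rcases x with ⟨_ | ⟨d, w⟩, i, b⟩ | a <;> simp only [PreEnd.cons] <;> split_ifs with h <;>
    simp [PreEnd.index, h]

/-- After prepending `b` with index `i` the word starts with `i`, so `a` is always merged into its
first letter and only associativity of addition is involved. -/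
theorem PreEnd.cons_cons (i : Bool) (a b : Lam n) (x : PreEnd n) :
    (x.cons (i, b)).cons (i, a) = x.cons (i, a + b) := by
  rcases x with ⟨_ | ⟨d, w⟩, j, e⟩ | u <;> simp only [PreEnd.cons] <;> split_ifs with h
  · subst h
    simp only [if_true]
    congr 1
    funext j
    rw [← add_assoc]
    rfl
  · simp
  · simp [h, add_assoc]
  · simp
  · simp only [h]
    refine (if_pos rfl).trans ?_
    congr 1
    funext k
    cases k
    · exact congrArg (Prod.mk _) (add_assoc _ _ _).symm
    · rfl
  · refine (if_pos rfl).trans ?_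
    congr 1

/-- The vertex with a single letter. -/
def Vertex.single (c : Letter n) (hc : 0 < c.2) : Vertex n :=
  ⟨[c], by simpa using hc, by simp⟩

/-- The root. -/
def Vertex.root (n : ℕ) : Vertex n := ⟨[], by simp, by simp⟩

@[simp] theorem Vertex.root_concat (x : Boundary n) : (Vertex.root n).concat x = x := rfl

@[simp] theorem Vertex.root_length : (Vertex.root n).length = 0 := rfl

@[simp] theorem Vertex.single_length (c : Letter n) (hc : 0 < c.2) :
    (Vertex.single c hc).length = c.2 := by simp [Vertex.single, Vertex.length]

/-! ### First letter and tail of an end. -/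

theorem IsBoundaryPos.n_pos {b : Fin n → WithTop ℤ} (hb : IsBoundaryPos b) : 0 < n := by
  obtain ⟨-, -, i, -⟩ := hb
  exact i.pos

/-- The first letter. -/
def PreEnd.first : PreEnd n → Fin n → WithTop ℤ
  | finite [] _ b => b
  | finite (d :: _) _ _ => fun j => ((d.2 j : ℤ) : WithTop ℤ)
  | infinite a => fun j => (((a 0).2 j : ℤ) : WithTop ℤ)

/-- The word without its first letter (a dummy value if there is a single letter). -/
def PreEnd.tail : PreEnd n → PreEnd n
  | finite [] _ _ => finite [] false 0
  | finite (_ :: w) i b => finite w i b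
  | infinite a => infinite fun k => a (k + 1)

theorem PreEnd.first_cons_of_eq {c : Letter n} {x : PreEnd n} (h : c.1 = x.index) :
    (x.cons c).first = fun j => ((c.2 j : ℤ) : WithTop ℤ) + x.first j := by
  rcases x with ⟨_ | ⟨d, w⟩, i, b⟩ | u <;> exact (congrArg PreEnd.first (if_pos h)).trans rfl

theorem PreEnd.first_cons_of_ne {c : Letter n} {x : PreEnd n} (h : c.1 ≠ x.index) :
    (x.cons c).first = fun j => ((c.2 j : ℤ) : WithTop ℤ) := by
  rcases x with ⟨_ | ⟨d, w⟩, i, b⟩ | u <;> exact (congrArg PreEnd.first (if_neg h)).trans rfl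

theorem PreEnd.tail_cons_of_eq {c : Letter n} {x : PreEnd n} (h : c.1 = x.index) :
    (x.cons c).tail = x.tail := by
  rcases x with ⟨_ | ⟨d, w⟩, i, b⟩ | u <;> exact (congrArg PreEnd.tail (if_pos h)).trans rfl

theorem PreEnd.tail_cons_of_ne {c : Letter n} {x : PreEnd n} (h : c.1 ≠ x.index) :
    (x.cons c).tail = x := by
  rcases x with ⟨_ | ⟨d, w⟩, i, b⟩ | u <;> exact (congrArg PreEnd.tail (if_neg h)).trans rfl

theorem PreEnd.IsEnd.first_pos {x : PreEnd n} (hx : x.IsEnd) :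
    (0 : Lex (Fin n → WithTop ℤ)) < toLex x.first := by
  have key : ∀ a : Lam n, 0 < a →
      (0 : Lex (Fin n → WithTop ℤ)) < toLex fun j => ((a j : ℤ) : WithTop ℤ) := by
    rintro a ⟨i, hi, hi'⟩
    refine ⟨i, fun j hj => ?_, ?_⟩
    · have h : (0 : ℤ) = a j := hi j hj
      change (0 : WithTop ℤ) = ((a j : ℤ) : WithTop ℤ)
      rw [← h]
      rfl
    · have h : 0 < a i := hi'
      change (0 : WithTop ℤ) < ((a i : ℤ) : WithTop ℤ)
      exact_mod_cast h
  rcases x with ⟨_ | ⟨d, w⟩, i, b⟩ | u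
  · exact hx.2.2.2.2
  · exact key _ (hx.1 d (by simp))
  · exact key _ (hx.1 0)

/-- The last coordinate of a letter of `∂Λ⁺` is `∞`, so the first letter already distinguishes words
consisting of one such letter from all others. The dummy value of `tail` is therefore never compared
with a genuine tail. -/
theorem PreEnd.IsEnd.ext {x y : PreEnd n} (hx : x.IsEnd) (hy : y.IsEnd) (hi : x.index = y.index)
    (hf : x.first = y.first) (ht : x.tail = y.tail) : x = y := by
  have key : ∀ {b : Fin n → WithTop ℤ}, IsBoundaryPos b → ∀ a : Lam n,
      b ≠ fun j => ((a j : ℤ) : WithTop ℤ) := by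
    rintro b hb a rfl
    have hn := hb.n_pos
    exact absurd (hb.1 ⟨n - 1, by omega⟩ (by simp; omega)) (by simp)
  rcases x with ⟨_ | ⟨⟨j, d⟩, w⟩, i, b⟩ | u <;> rcases y with ⟨_ | ⟨⟨j', d'⟩, w'⟩, i', b'⟩ | u' <;>
    simp only [PreEnd.index, PreEnd.first, PreEnd.tail] at hi hf ht
  · rw [hi, hf]
  · exact absurd hf (key hx.2.2 _)
  · exact absurd hf (key hx.2.2 _)
  · exact absurd hf.symm (key hy.2.2 _)
  · have : d = d' := by
      funext j
      exact WithTop.coe_injective (congrFun hf j)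
    cases ht
    rw [hi, this]
  · cases ht
  · exact absurd hf.symm (key hy.2.2 _)
  · cases ht
  · congr 1
    funext k
    cases k with
    | zero => exact Prod.ext hi (funext fun j => WithTop.coe_injective (congrFun hf j))
    | succ k => exact congrFun (PreEnd.infinite.inj ht) k

/-- The first letter of `c x` is `c` if the indices differ and `c` plus a positive element if they
agree. These cases cannot coincide, and within each case `c` can be cancelled. -/
theorem PreEnd.cons_injOn (c : Letter n) {x y : PreEnd n} (hx : x.IsEnd) (hy : y.IsEnd)
    (h : x.cons c = y.cons c) : x = y := by
  have hf := congrArg PreEnd.first h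
  have ht := congrArg PreEnd.tail h
  have key : ∀ {x : PreEnd n}, x.IsEnd →
      (fun j => ((c.2 j : ℤ) : WithTop ℤ) + x.first j) ≠ fun j => ((c.2 j : ℤ) : WithTop ℤ) := by
    intro x hx h
    refine hx.first_pos.ne (congrArg toLex (funext fun j => ?_))
    exact (WithTop.add_left_cancel (by simp) ((congrFun h j).trans (add_zero _).symm)).symm
  by_cases h1 : c.1 = x.index <;> by_cases h2 : c.1 = y.index
  · rw [first_cons_of_eq h1, first_cons_of_eq h2] at hf
    rw [tail_cons_of_eq h1, tail_cons_of_eq h2] at ht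
    exact hx.ext hy (h1.symm.trans h2)
      (funext fun j => WithTop.add_left_cancel (by simp) (congrFun hf j)) ht
  · rw [first_cons_of_eq h1, first_cons_of_ne h2] at hf
    exact absurd hf (key hx)
  · rw [first_cons_of_ne h1, first_cons_of_eq h2] at hf
    exact absurd hf.symm (key hy)
  · rwa [tail_cons_of_ne h1, tail_cons_of_ne h2] at ht

/-- The smallest positive element `(0, …, 0, 1)` of `Λ`. -/
def eps (n : ℕ) : Lam n := toLex fun i => if (i : ℕ) + 1 = n then 1 else 0

theorem eps_pos (hn : 0 < n) : 0 < eps n := by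
  refine ⟨⟨n - 1, by omega⟩, fun j hj => ?_, ?_⟩
  · have : (j : ℕ) < n - 1 := hj
    change (0 : ℤ) = if (j : ℕ) + 1 = n then 1 else 0
    rw [if_neg (by omega)]
  · change (0 : ℤ) < if n - 1 + 1 = n then 1 else 0
    rw [if_pos (by omega)]
    exact one_pos

theorem eps_le {a : Lam n} (ha : 0 < a) : eps n ≤ a := by
  obtain ⟨i, hi, hi'⟩ := ha
  have hi' : 0 < a i := hi'
  have hi : ∀ j < i, 0 = a j := hi
  by_cases hin : (i : ℕ) + 1 = n
  · rcases (show 1 ≤ a i from hi').lt_or_eq with h | h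
    · refine le_of_lt ⟨i, fun j hj => ?_, ?_⟩
      · have : (j : ℕ) < i := hj
        change (if (j : ℕ) + 1 = n then 1 else 0) = a j
        rw [if_neg (by omega), hi j hj]
      · change (if (i : ℕ) + 1 = n then 1 else 0) < a i
        rwa [if_pos hin]
    · refine le_of_eq (funext fun j => ?_)
      change (if (j : ℕ) + 1 = n then 1 else 0) = a j
      split_ifs with hj
      · rw [h]; congr 1; ext; omega
      · refine hi j (Fin.lt_def.2 ?_)
        have := j.isLt
        omega
  · refine le_of_lt ⟨i, fun j hj => ?_, ?_⟩
    · have : (j : ℕ) < i := hj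
      change (if (j : ℕ) + 1 = n then 1 else 0) = a j
      rw [if_neg (by omega), hi j hj]
    · change (if (i : ℕ) + 1 = n then 1 else 0) < a i
      rwa [if_neg hin]

/-- Only the last coordinate is changed by `eps`, and there `b` is `∞`. -/
theorem IsBoundaryPos.eps_add {b : Fin n → WithTop ℤ} (hb : IsBoundaryPos b) :
    (fun j => ((eps n j : ℤ) : WithTop ℤ) + b j) = b := by
  funext j
  change (((if (j : ℕ) + 1 = n then 1 else 0 : ℤ)) : WithTop ℤ) + b j = b j
  split_ifs with h
  · simp [hb.1 j h]
  · simp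

/-- A first letter in `∂Λ⁺` absorbs `eps`; a first letter in `Λ⁺` is at least `eps`, and the
difference is kept if it is positive and dropped if it is zero. -/
theorem PreEnd.exists_cons_eps {x : PreEnd n} (hx : x.IsEnd) :
    ∃ y : PreEnd n, y.IsEnd ∧ x = y.cons (x.index, eps n) := by
  rcases x with ⟨_ | ⟨⟨j, d⟩, w⟩, i, b⟩ | u
  · exact ⟨_, hx, by simp [PreEnd.cons, PreEnd.index, hx.2.2.eps_add]⟩
  · obtain ⟨h1, h2, h3⟩ := hx
    have hd : 0 < d := h1 (j, d) (by simp)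
    have h1' : ∀ a ∈ w, 0 < a.2 := fun a ha => h1 a (by simp [ha])
    have h2' : (w.map Prod.fst ++ [i]).IsChain (· ≠ ·) := (List.isChain_cons.1 h2).2
    rcases (eps_le hd).lt_or_eq with h | h
    · refine ⟨finite ((j, d - eps n) :: w) i b, ⟨?_, h2, h3⟩, ?_⟩
      · intro a ha
        rcases List.mem_cons.1 ha with rfl | ha
        · exact sub_pos.2 h
        · exact h1' a ha
      · simp [PreEnd.cons, PreEnd.index]
    · refine ⟨finite w i b, ⟨h1', h2', h3⟩, ?_⟩
      subst h
      rcases w with _ | ⟨e, w⟩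
      · have : j ≠ i := by simpa using h2
        simp [PreEnd.cons, PreEnd.index, this]
      · have : j ≠ e.1 := by
          have := (List.isChain_cons.1 h2).1
          simpa using this
        simp [PreEnd.cons, PreEnd.index, this]
  · obtain ⟨h1, h2⟩ := hx
    rcases (eps_le (h1 0)).lt_or_eq with h | h
    · refine ⟨infinite fun k => Nat.casesOn k ((u 0).1, (u 0).2 - eps n) fun m => u (m + 1),
        ⟨fun k => ?_, fun k => ?_⟩, ?_⟩
      · cases k with
        | zero => exact sub_pos.2 h
        | succ k => exact h1 (k + 1)
      · cases k with
        | zero => exact h2 0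
        | succ k => exact h2 (k + 1)
      · refine Eq.trans ?_ (if_pos rfl).symm
        congr 1
        funext k
        cases k with
        | zero => exact Prod.ext rfl (add_sub_cancel _ _).symm
        | succ k => rfl
    · refine ⟨infinite fun k => u (k + 1), ⟨fun k => h1 (k + 1), fun k => h2 (k + 1)⟩, ?_⟩
      refine Eq.trans ?_ (if_neg (h2 0)).symm
      congr 1
      funext k
      cases k with
      | zero => exact Prod.ext rfl h.symm
      | succ k => rfl

/-- The first index of an end. -/
def Boundary.index (x : Boundary n) : Bool := x.1.index

theorem index_single_concat (c : Letter n) (hc : 0 < c.2) (x : Boundary n) :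
    ((Vertex.single c hc).concat x).index = c.1 := PreEnd.index_cons c x.1

theorem single_concat_single_concat (i : Bool) {a b : Lam n} (ha : 0 < a) (hb : 0 < b)
    (x : Boundary n) :
    (Vertex.single (i, a) ha).concat ((Vertex.single (i, b) hb).concat x) =
      (Vertex.single (i, a + b) (add_pos ha hb)).concat x :=
  Subtype.ext (PreEnd.cons_cons i a b x.1)

theorem single_concat_injective (c : Letter n) (hc : 0 < c.2) :
    Function.Injective (Vertex.single c hc).concat := fun x y h =>
  Subtype.ext (PreEnd.cons_injOn c x.2 y.2 (congrArg Subtype.val h))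

theorem exists_single_eps_concat (hn : 0 < n) (x : Boundary n) :
    ∃ y, x = (Vertex.single (x.index, eps n) (eps_pos hn)).concat y := by
  obtain ⟨y, hy, h⟩ := PreEnd.exists_cons_eps x.2
  exact ⟨⟨y, hy⟩, Subtype.ext h⟩

/-! ### The monoid of words -/

theorem Vertex.mk_cons_concat (c : Letter n) (w : List (Letter n)) (h1 h2) (x : Boundary n) :
    (⟨c :: w, h1, h2⟩ : Vertex n).concat x = (Vertex.single c (h1 c (by simp))).concat
      ((⟨w, fun a ha => h1 a (by simp [ha]), (List.isChain_cons.1 h2).2⟩ : Vertex n).concat x) :=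
  rfl

theorem Vertex.mk_cons_length (c : Letter n) (w : List (Letter n)) (h1 h2) :
    (⟨c :: w, h1, h2⟩ : Vertex n).length = c.2 +
      (⟨w, fun a ha => h1 a (by simp [ha]), (List.isChain_cons.1 h2).2⟩ : Vertex n).length := by
  simp [Vertex.length]

theorem Vertex.induction {P : Vertex n → Prop} (root : P (Vertex.root n))
    (cons : ∀ c w h1 h2, P ⟨w, fun a ha => h1 a (by simp [ha]), (List.isChain_cons.1 h2).2⟩ →
      P ⟨c :: w, h1, h2⟩) (p : Vertex n) : P p := by
  obtain ⟨w, h1, h2⟩ := p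
  induction w with
  | nil => exact root
  | cons c w ih => exact cons c w h1 h2 (ih _ _)

/-- `r` represents the product of `p` and `q`. -/
def IsConcat (p q r : Vertex n) : Prop :=
  (∀ x, r.concat x = p.concat (q.concat x)) ∧ r.length = p.length + q.length

theorem exists_single_isConcat (c : Letter n) (hc : 0 < c.2) (q : Vertex n) :
    ∃ r, IsConcat (Vertex.single c hc) q r := by
  obtain ⟨w, h1, h2⟩ := q
  rcases w with _ | ⟨d, w⟩
  · exact ⟨Vertex.single c hc, fun x => rfl, by simp [Vertex.length]⟩
  · by_cases h : c.1 = d.1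
    · obtain ⟨i, a⟩ := c
      obtain ⟨j, b⟩ := d
      obtain rfl : i = j := h
      have hb : 0 < b := h1 (i, b) (by simp)
      refine ⟨⟨(i, a + b) :: w, ?_, ?_⟩, fun x => ?_, ?_⟩
      · intro e he
        rcases List.mem_cons.1 he with rfl | he
        · exact add_pos hc hb
        · exact h1 e (by simp [he])
      · rw [List.isChain_cons] at h2 ⊢
        exact h2
      · rw [Vertex.mk_cons_concat, Vertex.mk_cons_concat, single_concat_single_concat]
      · simp only [Vertex.mk_cons_length, Vertex.single_length]
        exact add_assoc _ _ _
    · refine ⟨⟨c :: d :: w, ?_, ?_⟩, fun x => rfl, ?_⟩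
      · intro e he
        rcases List.mem_cons.1 he with rfl | he
        · exact hc
        · exact h1 e he
      · exact List.isChain_cons.2 ⟨by simpa using h, h2⟩
      · simp only [Vertex.mk_cons_length, Vertex.single_length]

theorem exists_isConcat (p q : Vertex n) : ∃ r, IsConcat p q r := by
  induction p using Vertex.induction with
  | root => exact ⟨q, fun x => rfl, by simp⟩
  | cons c w h1 h2 ih =>
    obtain ⟨r, hr1, hr2⟩ := ih
    obtain ⟨s, hs1, hs2⟩ := exists_single_isConcat c (h1 c (by simp)) r
    refine ⟨s, fun x => ?_, ?_⟩
    · rw [hs1, hr1, Vertex.mk_cons_concat]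
    · rw [hs2, hr2, Vertex.mk_cons_length, Vertex.single_length, add_assoc]

/-! ### Cancellation, length and comparison of words. -/

theorem concat_injective (p : Vertex n) : Function.Injective p.concat := by
  induction p using Vertex.induction with
  | root => exact fun x y h => h
  | cons c w h1 h2 ih => exact fun x y h => ih (single_concat_injective c (h1 c (by simp)) h)

theorem length_nonneg (p : Vertex n) : 0 ≤ p.length :=
  List.sum_nonneg fun a ha => by
    obtain ⟨c, hc, rfl⟩ := List.mem_map.1 ha
    exact (p.pos c hc).le

theorem concat_eq_of_length_eq_zero {p : Vertex n} (h : p.length = 0) (x : Boundary n) :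
    p.concat x = x := by
  induction p using Vertex.induction with
  | root => rfl
  | cons c w h1 h2 ih =>
    rw [Vertex.mk_cons_length] at h
    exact absurd h (add_pos_of_pos_of_nonneg (h1 c (by simp)) (length_nonneg _)).ne'

theorem index_mk_cons_concat (c : Letter n) (w : List (Letter n)) (h1 h2) (x : Boundary n) :
    ((⟨c :: w, h1, h2⟩ : Vertex n).concat x).index = c.1 :=
    PreEnd.index_cons c _

/-- If the word `d w` is reduced then so is `w`, and `w x` does not start with the index of `d`
unless `w` is empty. -/
theorem eq_nil_of_index_eq {d : Letter n} {w : List (Letter n)}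
    (h2 : (d :: w).IsChain fun a b => a.1 ≠ b.1) (h1) (h3) {x : Boundary n}
    (h : ((⟨w, h1, h3⟩ : Vertex n).concat x).index = d.1) : w = [] := by
  rcases w with _ | ⟨e, w⟩
  · rfl
  · rw [index_mk_cons_concat] at h
    exact absurd h.symm ((List.isChain_cons.1 h2).1 e (by simp))

/-- Words with a common continuation are comparable. -/
theorem concat_eq_concat (p q : Vertex n) (x y : Boundary n) (h : p.concat x = q.concat y) :
    (∃ t, IsConcat p t q ∧ x = t.concat y) ∨ ∃ t, IsConcat q t p ∧ y = t.concat x := by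
  induction p using Vertex.induction generalizing q with
  | root => exact Or.inl ⟨q, ⟨fun _ => rfl, by simp⟩, h⟩
  | cons c w h1 h2 ih =>
    induction q using Vertex.induction with
    | root => exact Or.inr ⟨_, ⟨fun _ => rfl, by simp⟩, h.symm⟩
    | cons d v g1 g2 _ =>
      have hcd : c.1 = d.1 := by
        have := congrArg Boundary.index h
        rwa [index_mk_cons_concat, index_mk_cons_concat] at this
      obtain ⟨i, a⟩ := c
      obtain ⟨j, b⟩ := d
      obtain rfl : i = j := hcd
      have ha : 0 < a := h1 (i, a) (by simp)
      have hb : 0 < b := g1 (i, b) (by simp)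
      rw [Vertex.mk_cons_concat, Vertex.mk_cons_concat] at h
      -- The smaller first letter is cancelled. If something of the larger one is left over, the
      -- other side still starts with the same index, so its word must be exhausted because indices
      -- alternate.
      rcases lt_trichotomy a b with hab | rfl | hab
      · left
        have hba : 0 < b - a := sub_pos.2 hab
        have hs : ∀ z, (Vertex.single (i, b) hb).concat z = (Vertex.single (i, a) ha).concat
            ((Vertex.single (i, b - a) hba).concat z) := fun z => by
          rw [single_concat_single_concat]
          simp only [add_sub_cancel]
        rw [hs] at h
        have h' := single_concat_injective _ _ h
        have hw : w = [] := eq_nil_of_index_eq h2 _ _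
          ((congrArg Boundary.index h').trans (index_single_concat _ _ _))
        subst hw
        obtain ⟨t, ht1, ht2⟩ := exists_single_isConcat (i, b - a) hba ⟨v, _, (List.isChain_cons.1 g2).2⟩
        refine ⟨t, ⟨fun z => ?_, ?_⟩, ?_⟩
        · rw [ht1, Vertex.mk_cons_concat, hs]
          rfl
        · rw [ht2, Vertex.mk_cons_length, Vertex.single_length, ← add_assoc]
          simp [Vertex.length]
        · rw [ht1]
          exact h'
      · have h' := single_concat_injective _ _ h
        rcases ih _ h' with ⟨t, ⟨ht1, ht2⟩, ht⟩ | ⟨t, ⟨ht1, ht2⟩, ht⟩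
        · refine Or.inl ⟨t, ⟨fun z => ?_, ?_⟩, ht⟩
          · rw [Vertex.mk_cons_concat, ht1, Vertex.mk_cons_concat]
          · rw [Vertex.mk_cons_length, ht2, Vertex.mk_cons_length, add_assoc]
        · refine Or.inr ⟨t, ⟨fun z => ?_, ?_⟩, ht⟩
          · rw [Vertex.mk_cons_concat, ht1, Vertex.mk_cons_concat]
          · rw [Vertex.mk_cons_length, ht2, Vertex.mk_cons_length, add_assoc]
      · right
        have hba : 0 < a - b := sub_pos.2 hab
        have hs : ∀ z, (Vertex.single (i, a) ha).concat z = (Vertex.single (i, b) hb).concat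
            ((Vertex.single (i, a - b) hba).concat z) := fun z => by
          rw [single_concat_single_concat]
          simp only [add_sub_cancel]
        rw [hs] at h
        have h' := single_concat_injective _ _ h
        have hw : v = [] := eq_nil_of_index_eq g2 _ _
          ((congrArg Boundary.index h'.symm).trans (index_single_concat _ _ _))
        subst hw
        obtain ⟨t, ht1, ht2⟩ := exists_single_isConcat (i, a - b) hba ⟨w, _, (List.isChain_cons.1 h2).2⟩
        refine ⟨t, ⟨fun z => ?_, ?_⟩, ?_⟩
        · rw [ht1, Vertex.mk_cons_concat, hs]
          rfl
        · rw [ht2, Vertex.mk_cons_length, Vertex.single_length, ← add_assoc]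
          simp [Vertex.length]
        · rw [ht1]
          exact h'.symm

/-- If `p x = q y` and `l(p) ≤ l(q)` then `q = p t` and `x = t y` for some `t`. -/
theorem exists_isConcat_of_concat_eq {p q : Vertex n} {x y : Boundary n}
    (h : p.concat x = q.concat y) (hl : p.length ≤ q.length) :
    ∃ t, IsConcat p t q ∧ x = t.concat y := by
  rcases concat_eq_concat p q x y h with h | ⟨t, ⟨ht1, ht2⟩, ht⟩
  · exact h
  · have h0 : t.length = 0 :=
      le_antisymm (by rw [ht2] at hl; exact (add_le_iff_nonpos_right _).1 hl) (length_nonneg t)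
    have h1 := concat_eq_of_length_eq_zero h0
    refine ⟨Vertex.root n, ⟨fun z => ?_, ?_⟩, ?_⟩
    · rw [Vertex.root_concat, ht1, h1]
    · rw [Vertex.root_length, ht2, h0, add_zero, add_zero]
    · rw [ht, h1, Vertex.root_concat]

/-- The connecting word `t` has length zero, hence acts trivially. Equality of the two concatenation
maps is all that the product formulas need. -/
theorem concat_congr {p q : Vertex n} {x y : Boundary n} (h : p.concat x = q.concat y)
    (hl : p.length = q.length) : p.concat = q.concat ∧ x = y := by
  obtain ⟨t, ⟨ht1, ht2⟩, ht⟩ := exists_isConcat_of_concat_eq h hl.le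
  have h0 : t.length = 0 := by
    rw [hl] at ht2
    exact left_eq_add.1 ht2
  have h1 := concat_eq_of_length_eq_zero h0
  exact ⟨funext fun z => by rw [ht1, h1], by rw [ht, h1]⟩

instance : Countable (Lam n) := inferInstanceAs (Countable (Fin n → ℤ))

instance : Countable (Vertex n) :=
  Function.Injective.countable (f := Vertex.letters) fun p q h => by
    cases p; cases q; congr

/-! ### Cuts of `ℤⁿ` -/

/-- The inclusion of `Λ` in the lexicographically ordered `(ℤ ∪ {∞})ⁿ`. -/
def toTop (a : Lam n) : Lex (Fin n → WithTop ℤ) := toLex fun j => ((a j : ℤ) : WithTop ℤ)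

theorem toTop_lt_toTop {a b : Lam n} (h : a < b) : toTop a < toTop b := by
  obtain ⟨i, hi, hi'⟩ := h
  refine ⟨i, fun j hj => ?_, ?_⟩
  · have h : a j = b j := hi j hj
    exact congrArg _ h
  · have h : a i < b i := hi'
    change ((a i : ℤ) : WithTop ℤ) < ((b i : ℤ) : WithTop ℤ)
    exact_mod_cast h

/-- `a < b` because of one of the first `k` coordinates. -/
def LtUpTo (k : ℕ) (a b : Lam n) : Prop :=
  ∃ i : Fin n, (i : ℕ) < k ∧ (∀ j < i, a j = b j) ∧ a i < b i

/-- The supremum of the cut `D` is computed coordinate by coordinate. In the first alternative it is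
`(a₀, …, a_{j-1}, ∞, …)` for some `j < k`; in the second the first `k` coordinates have a
lexicographic maximum, attained at `a`. Passing to `k + 1`, the next coordinate among the elements
with the maximal prefix is either bounded, and its maximum is taken, or unbounded, and the cut ends
there. -/
theorem exists_prefix_of_cut {D : Set (Lam n)} (hne : D.Nonempty)
    (hdown : ∀ a ∈ D, ∀ a', 0 < a' → a' < a → a' ∈ D) (k : ℕ) (hk : k ≤ n) :
    (∃ j < k, ∃ a ∈ D, ∀ a', 0 < a' → (a' ∈ D ↔ ¬LtUpTo j a a')) ∨
      ∃ a ∈ D, ∀ a' ∈ D, ¬LtUpTo k a a' := by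
  induction k with
  | zero =>
    obtain ⟨a, ha⟩ := hne
    exact Or.inr ⟨a, ha, fun a' _ ⟨i, hi, _⟩ => absurd hi (Nat.not_lt_zero _)⟩
  | succ k ih =>
    rcases ih (by omega) with ⟨j, hj, h⟩ | ⟨a, ha, hmax⟩
    · exact Or.inl ⟨j, by omega, h⟩
    let κ : Fin n := ⟨k, by omega⟩
    by_cases hb : ∃ B : ℤ, ∀ a' ∈ D, (∀ i < κ, a i = a' i) → a' κ ≤ B
    · right
      obtain ⟨B, hB⟩ := hb
      obtain ⟨m, ⟨a', ha', hpre, rfl⟩, hm⟩ := Int.exists_greatest_of_bdd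
        (P := fun m => ∃ a' ∈ D, (∀ i < κ, a i = a' i) ∧ a' κ = m)
        ⟨B, fun m ⟨a', ha', hpre, hm⟩ => hm ▸ hB a' ha' hpre⟩ ⟨a κ, a, ha, fun _ _ => rfl, rfl⟩
      refine ⟨a', ha', ?_⟩
      rintro a'' ha'' ⟨i, hik, hi, hlt⟩
      rcases Nat.lt_succ_iff_lt_or_eq.1 hik with h | h
      · refine hmax a'' ha'' ⟨i, h, fun j hj => ?_, ?_⟩
        · rw [hpre j (hj.trans (Fin.lt_def.2 h)), hi j hj]
        · rwa [hpre i (Fin.lt_def.2 h)]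
      · obtain rfl : i = κ := Fin.ext h
        exact absurd (hm (a'' κ) ⟨a'', ha'', fun j hj => (hpre j hj).trans (hi j hj), rfl⟩)
          (not_le.2 hlt)
    · left
      push Not at hb
      refine ⟨k, by omega, a, ha, fun a' ha' => ⟨hmax a', fun hnot => ?_⟩⟩
      -- By unboundedness some `d ∈ D` has the maximal prefix and exceeds `a'` in coordinate `κ`;
      -- then `a' ≤ d` unless `a'` beats the prefix of `a`.
      obtain ⟨d, hd, hpre, hlt⟩ := hb (a' κ)
      rcases lt_trichotomy a' d with h | rfl | ⟨i, hi, hi'⟩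
      · exact hdown d hd a' ha' h
      · exact hd
      · have hi : ∀ j < i, d j = a' j := hi
        have hi' : d i < a' i := hi'
        rcases lt_trichotomy i κ with h | h | h
        · refine absurd ⟨i, Fin.lt_def.1 h, fun j hj => ?_, ?_⟩ hnot
          · rw [hpre j (hj.trans h), hi j hj]
          · rwa [hpre i h]
        · subst h
          exact absurd hi' hlt.not_gt
        · exact absurd (hi κ h) hlt.ne'

/-- The letter `b` is the supremum of the cut. By `hadd` the cut has no maximum, which excludes the
second alternative of `exists_prefix_of_cut` with `k = n`. -/
theorem exists_boundary_of_cut {D : Set (Lam n)} (hn : 0 < n) (hne : D.Nonempty)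
    (hpos : ∀ a ∈ D, 0 < a) (hdown : ∀ a ∈ D, ∀ a', 0 < a' → a' < a → a' ∈ D)
    (hadd : ∀ a ∈ D, a + eps n ∈ D) :
    ∃ b, IsBoundaryPos b ∧ ∀ a, 0 < a → (a ∈ D ↔ toTop a < toLex b) := by
  rcases exists_prefix_of_cut hne hdown n le_rfl with ⟨j, hj, a, ha, h⟩ | ⟨a, ha, hmax⟩
  · let b : Fin n → WithTop ℤ := fun i => if (i : ℕ) < j then ((a i : ℤ) : WithTop ℤ) else ⊤
    have hb : ∀ a', 0 < a' → (a' ∈ D ↔ toTop a' < toLex b) := by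
      intro a' ha'
      rw [h a' ha']
      constructor
      · intro hnot
        rcases lt_trichotomy (toTop a') (toLex b) with hlt | heq | ⟨i, hi, hi'⟩
        · exact hlt
        · have : ((a' ⟨j, hj⟩ : ℤ) : WithTop ℤ) = b ⟨j, hj⟩ := congrFun heq _
          simp [b] at this
        · have hi : ∀ m < i, b m = ((a' m : ℤ) : WithTop ℤ) := hi
          have hi' : b i < ((a' i : ℤ) : WithTop ℤ) := hi'
          have hij : (i : ℕ) < j := by
            by_contra hij
            simp [b, hij] at hi'
          refine absurd ⟨i, hij, fun m hm => ?_, ?_⟩ hnot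
          · have := hi m hm
            simp only [b, (show (m : ℕ) < j from (Fin.lt_def.1 hm).trans hij), if_true] at this
            exact_mod_cast this
          · simp only [b, hij, if_true] at hi'
            exact_mod_cast hi'
      · rintro hlt ⟨i, hij, hi, hi'⟩
        refine lt_asymm hlt ⟨i, fun m hm => ?_, ?_⟩
        · change b m = ((a' m : ℤ) : WithTop ℤ)
          simp only [b, (show (m : ℕ) < j from (Fin.lt_def.1 hm).trans hij), if_true, hi m hm]
        · change b i < ((a' i : ℤ) : WithTop ℤ)
          simp only [b, hij, if_true]
          exact_mod_cast hi'
    refine ⟨b, ⟨fun i hi => ?_, fun i m him hi => ?_, ?_⟩, hb⟩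
    · exact if_neg (by omega)
    · have hij : ¬(i : ℕ) < j := fun hij => by simp [b, hij] at hi
      have := Fin.le_def.1 him
      exact if_neg (by omega)
    · have h0 : toTop (0 : Lam n) < toLex b :=
        (toTop_lt_toTop (hpos a ha)).trans ((hb a (hpos a ha)).1 ha)
      exact h0
  · obtain ⟨i, hi, hi'⟩ := lt_add_of_pos_right a (eps_pos hn)
    exact absurd ⟨i, i.isLt, hi, hi'⟩ (hmax _ (hadd a ha))

/-- Let `j` be the first coordinate where `b` and `b'` differ. Since `b j` is finite, `j` is not the
last coordinate, which leaves room at `j + 1`. -/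
theorem IsBoundaryPos.exists_between {b b' : Fin n → WithTop ℤ} (hb : IsBoundaryPos b)
    (h : toLex b < toLex b') :
    ∃ a : Lam n, toLex b < toTop a ∧ toTop a < toLex b' := by
  obtain ⟨j, hj, hj'⟩ := h
  have hj : ∀ i < j, b i = b' i := hj
  have hj' : b j < b' j := hj'
  have hfin : ∀ i ≤ j, b i ≠ ⊤ := fun i hi h => hj'.ne_top (hb.2.1 i j hi h)
  have hjn : (j : ℕ) + 1 < n := by
    have h1 : (j : ℕ) + 1 ≠ n := fun h => hj'.ne_top (hb.1 j h)
    omega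
  -- Coordinate `j` exceeds that of `b` by one. If it thereby reaches `b' j`, coordinate `j + 1`
  -- puts `a` below `b'`; the default value `0` covers the case of an infinite entry.
  let a : Lam n := toLex fun i => if i < j then (b i).untopD 0 else if i = j then (b i).untopD 0 + 1
    else (b' i).untopD 0 - 1
  have ha1 : ∀ i < j, ((a i : ℤ) : WithTop ℤ) = b i := fun i hi => by
    obtain ⟨z, hz⟩ := WithTop.ne_top_iff_exists.1 (hfin i hi.le)
    have : a i = (b i).untopD 0 := if_pos hi
    rw [this, ← hz]
    rfl
  obtain ⟨z, hz⟩ := WithTop.ne_top_iff_exists.1 (hfin j le_rfl)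
  have ha2 : a j = z + 1 := by
    have : a j = (b j).untopD 0 + 1 := (if_neg (lt_irrefl j)).trans (if_pos rfl)
    rw [this, ← hz]
    rfl
  refine ⟨a, ⟨j, fun i hi => (ha1 i hi).symm, ?_⟩, ?_⟩
  · change b j < ((a j : ℤ) : WithTop ℤ)
    rw [← hz, ha2]
    exact_mod_cast lt_add_one z
  · have hle : ((a j : ℤ) : WithTop ℤ) ≤ b' j := by
      rw [ha2]
      rw [← hz] at hj'
      induction hw : b' j with
      | top => exact le_top
      | coe w =>
        rw [hw] at hj'
        have : z < w := by exact_mod_cast hj'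
        exact_mod_cast this
    rcases hle.lt_or_eq with hlt | heq
    · exact ⟨j, fun i hi => (ha1 i hi).trans (hj i hi), hlt⟩
    · let m : Fin n := ⟨j + 1, hjn⟩
      refine ⟨m, fun i hi => ?_, ?_⟩
      · rcases (show i ≤ j from Nat.lt_succ_iff.1 hi).lt_or_eq with h | rfl
        · exact (ha1 i h).trans (hj i h)
        · exact heq
      · have hm : a m = (b' m).untopD 0 - 1 :=
          (if_neg (fun h => absurd (Fin.lt_def.1 h) (by simp [m]))).trans
            (if_neg (fun h => absurd (congrArg Fin.val h) (by simp [m])))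
        change ((a m : ℤ) : WithTop ℤ) < b' m
        rw [hm]
        induction b' m with
        | top => exact WithTop.coe_lt_top _
        | coe w => exact_mod_cast sub_one_lt w

/-! ### Membership of ends in cylinders -/

/-- The end given by a single letter of `∂Λ⁺`. -/
def Boundary.letter (i : Bool) (b : Fin n → WithTop ℤ) (hb : IsBoundaryPos b) : Boundary n :=
  ⟨PreEnd.finite [] i b, by simp, by simp, hb⟩

theorem index_of_mem_cylinder_single {c : Letter n} {hc : 0 < c.2} {x : Boundary n}
    (h : x ∈ cylinder (Vertex.single c hc)) : x.index = c.1 := by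
  obtain ⟨y, rfl⟩ := h
  exact index_single_concat c hc y

/-- The continuation of `a` has to be the single letter `b - a`, and this lies in `∂Λ⁺` precisely
when `a < b`. -/
theorem letter_mem_cylinder_single {i j : Bool} {b : Fin n → WithTop ℤ} (hb : IsBoundaryPos b)
    {a : Lam n} (ha : 0 < a) :
    Boundary.letter i b hb ∈ cylinder (Vertex.single (j, a) ha) ↔ i = j ∧ toTop a < toLex b := by
  constructor
  · intro h
    have hi : i = j := index_of_mem_cylinder_single h
    subst hi
    obtain ⟨y, hy⟩ := h
    have hy : y.1.cons (i, a) = PreEnd.finite [] i b := congrArg Subtype.val hy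
    refine ⟨rfl, ?_⟩
    have hyi : i = y.1.index := by
      by_contra hne
      have := (PreEnd.first_cons_of_ne (c := (i, a)) hne).symm.trans (congrArg PreEnd.first hy)
      have hn := hb.n_pos
      have h2 := congrFun this ⟨n - 1, by omega⟩
      change ((a _ : ℤ) : WithTop ℤ) = b _ at h2
      rw [hb.1 _ (by simp; omega)] at h2
      exact absurd h2 (by simp)
    have hb2 : b = _ := (congrArg PreEnd.first hy).symm.trans (PreEnd.first_cons_of_eq (c := (i, a)) hyi)
    obtain ⟨k, hk, hk'⟩ := y.2.first_pos
    have hk : ∀ j < k, 0 = y.1.first j := hk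
    have hk' : 0 < y.1.first k := hk'
    refine ⟨k, fun j hj => ?_, ?_⟩
    · change ((a j : ℤ) : WithTop ℤ) = b j
      rw [hb2]
      change _ = ((a j : ℤ) : WithTop ℤ) + y.1.first j
      rw [← hk j hj, add_zero]
    · change ((a k : ℤ) : WithTop ℤ) < b k
      rw [hb2]
      have := WithTop.add_lt_add_left (x := ((a k : ℤ) : WithTop ℤ)) (by simp) hk'
      rwa [add_zero] at this
  · rintro ⟨rfl, k, hk, hk'⟩
    have hk : ∀ j < k, ((a j : ℤ) : WithTop ℤ) = b j := hk
    have hk' : ((a k : ℤ) : WithTop ℤ) < b k := hk'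
    have hcancel : ∀ z : ℤ, ((z : ℤ) : WithTop ℤ) + ((-z : ℤ) : WithTop ℤ) = 0 := fun z => by
      rw [← WithTop.coe_add, add_neg_cancel]
      rfl
    refine ⟨Boundary.letter i (fun j => ((-(a j) : ℤ) : WithTop ℤ) + b j) ⟨fun j hj => ?_,
      fun j m hjm hj => ?_, k, fun j hj => ?_, ?_⟩, Subtype.ext ?_⟩
    · simp [hb.1 j hj]
    · have : b j = ⊤ := by simpa using hj
      simp [hb.2.1 j m hjm this]
    · change (0 : WithTop ℤ) = ((-(a j) : ℤ) : WithTop ℤ) + b j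
      rw [← hk j hj, add_comm, hcancel]
    · change (0 : WithTop ℤ) < ((-(a k) : ℤ) : WithTop ℤ) + b k
      have := WithTop.add_lt_add_left (x := ((-(a k) : ℤ) : WithTop ℤ)) (by simp) hk'
      rwa [add_comm, hcancel] at this
    · refine (if_pos rfl).trans ?_
      congr 1
      funext j
      rw [← add_assoc, hcancel, zero_add]

/-- As `y` starts with the other index, the first letter of the word is exactly `a`, with nothing
merged into it. -/
theorem single_concat_mem_cylinder_single {i : Bool} {a a' : Lam n} (ha : 0 < a) (ha' : 0 < a')
    {y : Boundary n} (hy : y.index ≠ i) :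
    (Vertex.single (i, a) ha).concat y ∈ cylinder (Vertex.single (i, a') ha') ↔ a' ≤ a := by
  constructor
  · rintro ⟨z, hz⟩
    by_contra hlt
    rw [not_le] at hlt
    have : (Vertex.single (i, a') ha').concat z = (Vertex.single (i, a) ha).concat
        ((Vertex.single (i, a' - a) (sub_pos.2 hlt)).concat z) := by
      rw [single_concat_single_concat]
      simp only [add_sub_cancel]
    rw [this] at hz
    rw [← single_concat_injective _ _ hz, index_single_concat] at hy
    exact hy rfl
  · intro h
    rcases h.lt_or_eq with h | rfl
    · refine ⟨(Vertex.single (i, a - a') (sub_pos.2 h)).concat y, ?_⟩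
      rw [single_concat_single_concat]
      simp only [add_sub_cancel]
    · exact ⟨y, rfl⟩

theorem cylinder_single_subset {i : Bool} {a a' : Lam n} (ha : 0 < a) (ha' : 0 < a') (h : a' < a) :
    cylinder (Vertex.single (i, a) ha) ⊆ cylinder (Vertex.single (i, a') ha') := by
  rintro _ ⟨y, rfl⟩
  refine ⟨(Vertex.single (i, a - a') (sub_pos.2 h)).concat y, ?_⟩
  rw [single_concat_single_concat]
  simp only [add_sub_cancel]

/-- A first letter of the same index contributes at least `eps`. Together with the previous
criterion, membership in `V(a)` but not in `V(a + eps)` expresses that the first letter is exactly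
`a`. -/
theorem single_concat_mem_of_index_eq (hn : 0 < n) {i : Bool} {a : Lam n} (ha : 0 < a)
    {y : Boundary n} (hy : y.index = i) :
    (Vertex.single (i, a) ha).concat y ∈
      cylinder (Vertex.single (i, a + eps n) (add_pos ha (eps_pos hn))) := by
  obtain ⟨z, hz⟩ := exists_single_eps_concat hn y
  subst hy
  exact ⟨z, by rw [← single_concat_single_concat _ ha (eps_pos hn), ← hz]⟩

theorem Boundary.cases (x : Boundary n) : (∃ i b hb, x = Boundary.letter i b hb) ∨
    ∃ c hc, ∃ y : Boundary n, y.index ≠ c.1 ∧ x = (Vertex.single c hc).concat y := by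
  obtain ⟨⟨_ | ⟨d, w⟩, i, b⟩ | u, hx⟩ := x
  · exact Or.inl ⟨i, b, hx.2.2, rfl⟩
  · right
    obtain ⟨h1, h2, h3⟩ := hx
    let y : Boundary n := ⟨PreEnd.finite w i b, fun a ha => h1 a (by simp [ha]),
      (List.isChain_cons.1 h2).2, h3⟩
    have hy : d.1 ≠ y.1.index := by
      rcases w with _ | ⟨e, w⟩
      · exact (List.isChain_cons.1 h2).1 i (by simp)
      · exact (List.isChain_cons.1 h2).1 e.1 (by simp)
    refine ⟨d, h1 d (by simp), y, hy.symm, Subtype.ext ?_⟩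
    rcases w with _ | ⟨e, w⟩ <;> exact (if_neg hy).symm
  · right
    refine ⟨u 0, hx.1 0, ⟨PreEnd.infinite fun k => u (k + 1), fun k => hx.1 _, fun k => hx.2 _⟩,
      (hx.2 0).symm, Subtype.ext ?_⟩
    refine Eq.trans (congrArg PreEnd.infinite (funext fun k => ?_)) (if_neg (hx.2 0)).symm
    cases k <;> rfl

/-! ### Ultrafilters on the boundary -/

/-- Two ultrafilters contain the same sets `V(p)`. -/
def SameCylinders (U W : Ultrafilter (Boundary n)) : Prop := ∀ p, cylinder p ∈ U ↔ cylinder p ∈ W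

theorem cylinder_root : cylinder (Vertex.root n) = Set.univ :=
  Set.eq_univ_of_forall fun x => ⟨x, rfl⟩

theorem IsConcat.cylinder_eq {p q r : Vertex n} (h : IsConcat p q r) :
    cylinder r = p.concat '' cylinder q := by
  ext x
  constructor
  · rintro ⟨y, rfl⟩
    exact ⟨q.concat y, ⟨y, rfl⟩, (h.1 y).symm⟩
  · rintro ⟨_, ⟨y, rfl⟩, rfl⟩
    exact ⟨y, h.1 y⟩

/-- If `V(q)` meets the image of `p`, then `p` and `q` are comparable: `q` is a prefix of `p`, or `q
= p t`. -/
theorem preimage_cylinder (p q : Vertex n) :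
    (p.concat ⁻¹' cylinder q = Set.univ) ∨ (p.concat ⁻¹' cylinder q = ∅) ∨
      ∃ t, IsConcat p t q ∧ p.concat ⁻¹' cylinder q = cylinder t := by
  rcases (p.concat ⁻¹' cylinder q).eq_empty_or_nonempty with h | ⟨x, y, hy⟩
  · exact Or.inr (Or.inl h)
  · rcases concat_eq_concat p q x y hy.symm with ⟨t, ht, -⟩ | ⟨t, ht, -⟩
    · refine Or.inr (Or.inr ⟨t, ht, ?_⟩)
      rw [ht.cylinder_eq, Set.preimage_image_eq _ (concat_injective p)]
    · exact Or.inl (Set.eq_univ_of_forall fun z => ⟨t.concat z, (ht.1 z).symm⟩)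

theorem SameCylinders.map {U W : Ultrafilter (Boundary n)} (h : SameCylinders U W) (p : Vertex n) :
    SameCylinders (U.map p.concat) (W.map p.concat) := fun q => by
  rw [Ultrafilter.mem_map, Ultrafilter.mem_map]
  rcases preimage_cylinder p q with h1 | h1 | ⟨t, -, h1⟩
  · rw [h1]
    exact iff_of_true Filter.univ_mem Filter.univ_mem
  · simp [h1]
  · rw [h1]
    exact h t

theorem index_mem_iff (hn : 0 < n) (U : Ultrafilter (Boundary n)) (i : Bool) :
    {x | Boundary.index x = i} ∈ U ↔ cylinder (Vertex.single (i, eps n) (eps_pos hn)) ∈ U := by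
  suffices h : {x | Boundary.index x = i} = cylinder (Vertex.single (i, eps n) (eps_pos hn)) by
    rw [h]
  ext x
  constructor
  · rintro rfl
    obtain ⟨y, hy⟩ := exists_single_eps_concat hn x
    exact ⟨y, hy.symm⟩
  · exact fun h => index_of_mem_cylinder_single h

theorem exists_index_mem (U : Ultrafilter (Boundary n)) : ∃ i, {x | Boundary.index x = i} ∈ U := by
  rcases U.mem_or_compl_mem {x | Boundary.index x = true} with h | h
  · exact ⟨true, h⟩
  · exact ⟨false, Filter.mem_of_superset h fun x hx => by simpa using hx⟩

theorem index_unique {U : Ultrafilter (Boundary n)} {i j : Bool}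
    (hi : {x | Boundary.index x = i} ∈ U) (hj : {x | Boundary.index x = j} ∈ U) : i = j := by
  obtain ⟨x, hx, hx'⟩ := U.nonempty_of_mem (Filter.inter_mem hi hj)
  exact hx.symm.trans hx'

/-- An ultrafilter of words with first index `i` whose first letters have no maximum is determined
by the sets `V(p)` with `p` a single letter. -/
theorem sameCylinders_of_forall_add (hn : 0 < n) {U W : Ultrafilter (Boundary n)} {i : Bool}
    (hU : {x | Boundary.index x = i} ∈ U) (hW : {x | Boundary.index x = i} ∈ W)
    (hadd : ∀ a (ha : 0 < a), cylinder (Vertex.single (i, a) ha) ∈ U →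
      cylinder (Vertex.single (i, a + eps n) (add_pos ha (eps_pos hn))) ∈ U)
    (h : ∀ a (ha : 0 < a), cylinder (Vertex.single (i, a) ha) ∈ U ↔
      cylinder (Vertex.single (i, a) ha) ∈ W) : SameCylinders U W := by
  -- In `V(c d …)` the first letter is exactly `c`, whereas `hadd` would force it to be at least `c
  -- + eps` on a set of the ultrafilter.
  have key : ∀ U : Ultrafilter (Boundary n), {x | Boundary.index x = i} ∈ U →
      (∀ a (ha : 0 < a), cylinder (Vertex.single (i, a) ha) ∈ U →
        cylinder (Vertex.single (i, a + eps n) (add_pos ha (eps_pos hn))) ∈ U) →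
      ∀ c d w h1 h2, cylinder (⟨c :: d :: w, h1, h2⟩ : Vertex n) ∉ U := by
    rintro U hU hadd ⟨j, a⟩ d w h1 h2 hmem
    have hsub : cylinder (⟨(j, a) :: d :: w, h1, h2⟩ : Vertex n) ⊆
        cylinder (Vertex.single (j, a) (h1 _ (by simp))) := by
      rintro _ ⟨y, rfl⟩
      exact ⟨_, (Vertex.mk_cons_concat (j, a) _ h1 h2 y).symm⟩
    have hj := Filter.mem_of_superset hmem hsub
    obtain rfl : i = j := index_unique hU
      (Filter.mem_of_superset hj fun x hx => index_of_mem_cylinder_single hx)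
    obtain ⟨_, ⟨y, rfl⟩, hy⟩ := U.nonempty_of_mem (Filter.inter_mem hmem (hadd _ _ hj))
    rw [Vertex.mk_cons_concat, single_concat_mem_cylinder_single] at hy
    · exact absurd hy (not_le.2 (lt_add_of_pos_right a (eps_pos hn)))
    · rw [index_mk_cons_concat]
      exact ((List.isChain_cons.1 h2).1 d (by simp)).symm
  rintro ⟨w, h1, h2⟩
  rcases w with _ | ⟨⟨j, a⟩, _ | ⟨d, w⟩⟩
  · have : cylinder (⟨[], h1, h2⟩ : Vertex n) = Set.univ := cylinder_root
    rw [this]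
    exact iff_of_true Filter.univ_mem Filter.univ_mem
  · by_cases hij : i = j
    · subst hij
      exact h a (h1 (i, a) (by simp))
    · have : ∀ U : Ultrafilter (Boundary n), {x | Boundary.index x = i} ∈ U →
          cylinder (⟨[(j, a)], h1, h2⟩ : Vertex n) ∉ U := fun U hU hmem =>
        hij (index_unique hU (Filter.mem_of_superset hmem fun x hx =>
          index_of_mem_cylinder_single (c := (j, a)) (hc := h1 _ (by simp)) hx))
      exact iff_of_false (this U hU) (this W hW)
  · refine iff_of_false (key U hU hadd _ _ _ _ _) (key W hW (fun a ha hmem => ?_) _ _ _ _ _)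
    rw [← h] at hmem ⊢
    exact hadd a ha hmem

/-- An ultrafilter converges to an end given by a single letter, or it is the image of another one
under the concatenation with a letter. -/
theorem ultrafilter_cases (hn : 0 < n) (U : Ultrafilter (Boundary n)) :
    (∃ x, SameCylinders U (pure x)) ∨ ∃ c hc, ∃ U' : Ultrafilter (Boundary n),
      U = U'.map (Vertex.single c hc).concat ∧ {y | Boundary.index y ≠ c.1} ∈ U' := by
  obtain ⟨i, hi⟩ := exists_index_mem U
  -- Either the first letters have no maximum along `U`, and their cut defines the limit, or `U`
  -- contains `V(a)` but not `V(a + eps)`, and the letter `a` can be split off.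
  by_cases hadd : ∀ a (ha : 0 < a), cylinder (Vertex.single (i, a) ha) ∈ U →
      cylinder (Vertex.single (i, a + eps n) (add_pos ha (eps_pos hn))) ∈ U
  · left
    obtain ⟨b, hb, hD⟩ := exists_boundary_of_cut
      (D := {a | ∃ ha : 0 < a, cylinder (Vertex.single (i, a) ha) ∈ U}) hn
      ⟨eps n, eps_pos hn, (index_mem_iff hn U i).1 hi⟩ (fun a ha => ha.1)
      (fun a ⟨ha, h⟩ a' ha' hlt => ⟨ha', Filter.mem_of_superset h (cylinder_single_subset ha ha' hlt)⟩)
      (fun a ⟨ha, h⟩ => ⟨_, hadd a ha h⟩)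
    refine ⟨Boundary.letter i b hb, sameCylinders_of_forall_add hn hi ?_ hadd fun a ha => ?_⟩
    · exact Ultrafilter.mem_pure.2 rfl
    · rw [Ultrafilter.mem_pure, letter_mem_cylinder_single, ← hD a ha]
      exact ⟨fun h => ⟨rfl, ha, h⟩, fun h => h.2.2⟩
  · right
    push Not at hadd
    obtain ⟨a, ha, h1, h2⟩ := hadd
    let U' := U.comap (single_concat_injective (i, a) ha) h1
    have hU : U = U'.map (Vertex.single (i, a) ha).concat :=
      Ultrafilter.coe_injective (Filter.map_comap_of_mem h1).symm
    refine ⟨(i, a), ha, U', hU, ?_⟩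
    rw [hU, Ultrafilter.mem_map, ← Ultrafilter.compl_mem_iff_notMem] at h2
    exact Filter.mem_of_superset h2 fun y hy hyi => hy (single_concat_mem_of_index_eq hn ha hyi)

/-- If `d w = e t` with different letters `d`, `e` of the same index, then `t` is not empty and
starts with this index. -/
theorem index_eq_of_isConcat {d e : Letter n} {w : List (Letter n)} {h1 h2} {he : 0 < e.2}
    {t : Vertex n} (hi : e.1 = d.1) (hne : e ≠ d)
    (ht : IsConcat (Vertex.single e he) t ⟨d :: w, h1, h2⟩) :
    ∀ y ∈ cylinder t, y.index = e.1 := by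
  obtain ⟨i, a⟩ := d
  obtain ⟨j, a'⟩ := e
  obtain rfl : j = i := hi
  have ha : 0 < a := h1 (j, a) (by simp)
  have hconcat : ∀ y, (Vertex.single (j, a') he).concat (t.concat y) =
      (Vertex.single (j, a) ha).concat ((⟨w, fun a ha => h1 a (by simp [ha]),
        (List.isChain_cons.1 h2).2⟩ : Vertex n).concat y) := fun y => (ht.1 y).symm
  have hlen := ht.2
  rw [Vertex.mk_cons_length, Vertex.single_length] at hlen
  have hsub : ∀ {a b : Lam n} (ha : 0 < a) (hb : 0 < b) (hab : a < b) (z : Boundary n),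
      (Vertex.single (j, b) hb).concat z = (Vertex.single (j, a) ha).concat
        ((Vertex.single (j, b - a) (sub_pos.2 hab)).concat z) := fun ha hb hab z => by
    rw [single_concat_single_concat]
    simp only [add_sub_cancel]
  rintro _ ⟨y, rfl⟩
  rcases lt_trichotomy a a' with hlt | rfl | hlt
  · exfalso
    have hw : w = [] := by
      refine eq_nil_of_index_eq h2 (fun a ha => h1 a (by simp [ha])) (List.isChain_cons.1 h2).2
        (x := y) ?_
      have h3 := hconcat y
      rw [hsub ha he hlt] at h3
      rw [← single_concat_injective _ _ h3, index_single_concat]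
    subst hw
    have h5 : a' ≤ a' + t.length := le_add_of_nonneg_right (length_nonneg t)
    rw [← hlen] at h5
    refine absurd hlt (not_lt.2 (h5.trans (le_of_eq ?_)))
    simp [Vertex.length]
  · exact absurd rfl hne
  · have h3 := hconcat y
    rw [hsub he ha hlt] at h3
    rw [single_concat_injective _ _ h3, index_single_concat]

/-- If letters can be split off for ever, the limit is the infinite word they form. -/
theorem SameCylinders.infinite {U : ℕ → Ultrafilter (Boundary n)} {c : ℕ → Letter n}
    (hc : ∀ k, 0 < (c k).2) (hU : ∀ k, U k = (U (k + 1)).map (Vertex.single (c k) (hc k)).concat)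
    (hidx : ∀ k, {y | Boundary.index y ≠ (c k).1} ∈ U (k + 1)) :
    ∃ x, SameCylinders (U 0) (pure x) := by
  have hUi : ∀ k, {y | Boundary.index y = (c k).1} ∈ U k := fun k => by
    rw [hU k, Ultrafilter.mem_map]
    exact Filter.univ_mem' fun y => index_single_concat _ (hc k) y
  have hne : ∀ k, (c k).1 ≠ (c (k + 1)).1 := fun k h => by
    obtain ⟨y, hy, hy'⟩ := (U (k + 1)).nonempty_of_mem (Filter.inter_mem (hidx k) (hUi (k + 1)))
    exact hy (hy'.trans h.symm)
  let x : ℕ → Boundary n := fun k => ⟨PreEnd.infinite fun m => c (k + m), fun m => hc _, fun m =>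
    hne (k + m)⟩
  have hx : ∀ k, x k = (Vertex.single (c k) (hc k)).concat (x (k + 1)) := fun k => by
    refine Subtype.ext (Eq.trans (congrArg PreEnd.infinite (funext fun m => ?_))
      (if_neg (hne k)).symm)
    cases m with
    | zero => rfl
    | succ m => exact congrArg c (by omega)
  -- The claim is proved for all shifts `k` at once, so that removing a letter of `p` can be matched
  -- by passing from `k` to `k + 1`.
  suffices H : ∀ p k, cylinder p ∈ U k ↔ x k ∈ cylinder p from ⟨x 0, fun p => H p 0⟩
  intro p
  induction p using Vertex.induction with
  | root =>
    intro k
    rw [cylinder_root]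
    exact iff_of_true Filter.univ_mem trivial
  | cons d w h1 h2 ih =>
    intro k
    have hpre : ∀ {S : Set (Boundary n)}, (Vertex.single (c k) (hc k)).concat ⁻¹'
        cylinder ⟨d :: w, h1, h2⟩ = S → ((S ∈ U (k + 1)) ↔ x (k + 1) ∈ S) →
        (cylinder ⟨d :: w, h1, h2⟩ ∈ U k ↔ x k ∈ cylinder ⟨d :: w, h1, h2⟩) := by
      rintro S rfl hS
      rw [hU k, Ultrafilter.mem_map, hS, hx k]
      rfl
    -- Both `U (k + 1)` and `x (k + 1)` live on words whose first index differs from that of `c k`,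
    -- so neither sees such a cylinder.
    have hdisj : ∀ q : Vertex n, (∀ y ∈ cylinder q, y.index = (c k).1) →
        (cylinder q ∈ U (k + 1) ↔ x (k + 1) ∈ cylinder q) := fun q hq => by
      refine iff_of_false (fun hmem => ?_) fun hmem => ?_
      · obtain ⟨y, hy, hy'⟩ := (U (k + 1)).nonempty_of_mem (Filter.inter_mem hmem (hidx k))
        exact hy' (hq y hy)
      · exact hne k ((hq _ hmem).symm)
    by_cases hi : (c k).1 = d.1
    swap
    · refine hpre (S := ∅) (Set.eq_empty_of_forall_notMem ?_) (by simp)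
      rintro y ⟨z, hz⟩
      have := congrArg Boundary.index hz
      rw [index_mk_cons_concat, index_single_concat] at this
      exact hi this.symm
    have hdpos : 0 < d.2 := h1 d (by simp)
    rcases preimage_cylinder (Vertex.single (c k) (hc k)) ⟨d :: w, h1, h2⟩ with h | h | ⟨t, ht, h⟩
    · exact hpre h (iff_of_true Filter.univ_mem trivial)
    · exact hpre h (by simp)
    · refine hpre h ?_
      by_cases hcd : c k = d
      · have : cylinder t = cylinder ⟨w, fun a ha => h1 a (by simp [ha]),
            (List.isChain_cons.1 h2).2⟩ := by
          refine congrArg Set.range (funext fun y => ?_)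
          have h3 := ht.1 y
          rw [Vertex.mk_cons_concat] at h3
          subst hcd
          exact (single_concat_injective _ _ h3).symm
        rw [this]
        exact ih (k + 1)
      · exact hdisj t (index_eq_of_isConcat hi hcd ht)

/-- A limit of the remaining ultrafilter gives one of the original by prepending the letter. Hence
an ultrafilter without limit admits splitting off letters indefinitely, always without limit,
contradicting `SameCylinders.infinite`. -/
theorem exists_sameCylinders_pure (hn : 0 < n) (U : Ultrafilter (Boundary n)) :
    ∃ x, SameCylinders U (pure x) := by
  by_contra hU
  have step : ∀ U : {U : Ultrafilter (Boundary n) // ¬∃ x, SameCylinders U (pure x)},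
      ∃ c hc, ∃ U' : {U : Ultrafilter (Boundary n) // ¬∃ x, SameCylinders U (pure x)},
        U.1 = U'.1.map (Vertex.single c hc).concat ∧ {y | Boundary.index y ≠ c.1} ∈ U'.1 := by
    rintro ⟨U, hU⟩
    rcases ultrafilter_cases hn U with h | ⟨c, hc, U', h, h'⟩
    · exact absurd h hU
    · refine ⟨c, hc, ⟨U', ?_⟩, h, h'⟩
      rintro ⟨x, hx⟩
      refine hU ⟨(Vertex.single c hc).concat x, ?_⟩
      rw [h, ← Ultrafilter.map_pure]
      exact hx.map _
  choose c hc next h1 h2 using step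
  let s : ℕ → {U : Ultrafilter (Boundary n) // ¬∃ x, SameCylinders U (pure x)} :=
    fun k => next^[k] ⟨U, hU⟩
  have hs : ∀ k, s (k + 1) = next (s k) := fun k => Function.iterate_succ_apply' _ _ _
  refine hU (SameCylinders.infinite (U := fun k => (s k).1) (c := fun k => c (s k))
    (fun k => hc _) (fun k => ?_) fun k => ?_)
  · simp only [hs]
    exact h1 _
  · simp only [hs]
    exact h2 _

/-! ### Ends are separated by cylinders -/

/-- The ends `x` and `y` lie in the same sets `V(p)`. -/
def SameEnd (x y : Boundary n) : Prop := ∀ p : Vertex n, x ∈ cylinder p ↔ y ∈ cylinder p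

theorem SameEnd.symm {x y : Boundary n} (h : SameEnd x y) : SameEnd y x := fun p => (h p).symm

theorem SameEnd.of_concat {p : Vertex n} {x y : Boundary n}
    (h : SameEnd (p.concat x) (p.concat y)) : SameEnd x y := fun q => by
  obtain ⟨r, hr⟩ := exists_isConcat p q
  have := h r
  rwa [hr.cylinder_eq, (concat_injective p).mem_set_image, (concat_injective p).mem_set_image]
    at this

/-- The sets `V(c)` and `V(c + eps)` detect that the first letter is exactly `c`, so `y` has the
same first letter. -/
theorem SameEnd.concat_single (hn : 0 < n) {c : Letter n} {hc : 0 < c.2} {x y : Boundary n}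
    (hx : x.index ≠ c.1) (h : SameEnd ((Vertex.single c hc).concat x) y) :
    ∃ y', y'.index ≠ c.1 ∧ y = (Vertex.single c hc).concat y' ∧ SameEnd x y' := by
  obtain ⟨y', rfl⟩ := (h (Vertex.single c hc)).1 ⟨x, rfl⟩
  refine ⟨y', fun hy => ?_, rfl, h.of_concat⟩
  have := (h _).2 (single_concat_mem_of_index_eq hn hc hy)
  rw [single_concat_mem_cylinder_single (i := c.1) (a := c.2) hc _ hx] at this
  exact absurd this (not_le.2 (lt_add_of_pos_right _ (eps_pos hn)))

/-- Below `b ∈ ∂Λ⁺` there is no largest element of `Λ`: `a < b` implies `a + eps < b`. In contrast,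
a word with exact first letter `a` does not lie in `V(a + eps)`. -/
theorem not_sameEnd_letter_concat (hn : 0 < n) {i : Bool} {b : Fin n → WithTop ℤ}
    (hb : IsBoundaryPos b) {c : Letter n} {hc : 0 < c.2} {x : Boundary n} (hx : x.index ≠ c.1) :
    ¬SameEnd (Boundary.letter i b hb) ((Vertex.single c hc).concat x) := by
  obtain ⟨j, a⟩ := c
  intro h
  obtain ⟨hij, hlt⟩ := (letter_mem_cylinder_single hb hc).1 ((h (Vertex.single (j, a) hc)).2 ⟨x, rfl⟩)
  have hlt' : toTop (a + eps n) < toLex b := by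
    obtain ⟨k, hk, hk'⟩ := hlt
    have hk'' : ((a k : ℤ) : WithTop ℤ) < b k := hk'
    by_cases hkn : (k : ℕ) + 1 = n
    · refine ⟨k, fun m hm => ?_, ?_⟩
      · have h1 : ((a m : ℤ) : WithTop ℤ) = b m := hk m hm
        have h2 : (a + eps n) m = a m := by
          have : (m : ℕ) < k := hm
          change a m + (if (m : ℕ) + 1 = n then 1 else 0) = a m
          rw [if_neg (by omega), add_zero]
        change (((a + eps n) m : ℤ) : WithTop ℤ) = b m
        rw [h2, h1]
      · change (((a + eps n) k : ℤ) : WithTop ℤ) < b k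
        rw [hb.1 k hkn]
        exact WithTop.coe_lt_top _
    · have hm' : ∀ m ≤ k, (a + eps n) m = a m := fun m hm => by
        have : (m : ℕ) ≤ k := hm
        have := k.isLt
        change a m + (if (m : ℕ) + 1 = n then 1 else 0) = a m
        rw [if_neg (by omega), add_zero]
      refine ⟨k, fun m hm => ?_, ?_⟩
      · change (((a + eps n) m : ℤ) : WithTop ℤ) = b m
        rw [hm' m (le_of_lt hm)]
        exact hk m hm
      · change (((a + eps n) k : ℤ) : WithTop ℤ) < b k
        rwa [hm' k le_rfl]
  have := (h (Vertex.single (j, a + eps n) (add_pos hc (eps_pos hn)))).1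
    ((letter_mem_cylinder_single hb _).2 ⟨hij, hlt'⟩)
  rw [single_concat_mem_cylinder_single hc _ hx] at this
  exact absurd this (not_le.2 (lt_add_of_pos_right _ (eps_pos hn)))

theorem SameEnd.eq_of_letter (hn : 0 < n) {i : Bool} {b : Fin n → WithTop ℤ}
    (hb : IsBoundaryPos b) {y : Boundary n} (h : SameEnd (Boundary.letter i b hb) y) :
    Boundary.letter i b hb = y := by
  rcases y.cases with ⟨j, b', hb', rfl⟩ | ⟨c, hc, x, hx, rfl⟩
  · have key : ∀ {i j : Bool} {b b' : Fin n → WithTop ℤ} {hb : IsBoundaryPos b}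
        {hb' : IsBoundaryPos b'}, SameEnd (Boundary.letter i b hb) (Boundary.letter j b' hb') →
        ¬toLex b < toLex b' := by
      intro i j b b' hb hb' h hlt
      obtain ⟨a, h1, h2⟩ := hb.exists_between hlt
      have ha : 0 < a := by
        by_contra ha
        rcases (not_lt.1 ha).lt_or_eq with ha | rfl
        · exact lt_asymm (hb.2.2.trans h1) (toTop_lt_toTop ha)
        · exact lt_asymm hb.2.2 h1
      have := (h (Vertex.single (j, a) ha)).2 ((letter_mem_cylinder_single hb' ha).2 ⟨rfl, h2⟩)
      exact lt_asymm h1 ((letter_mem_cylinder_single hb ha).1 this).2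
    have hbb : b = b' := le_antisymm (α := Lex (Fin n → WithTop ℤ)) (not_lt.1 (key h.symm))
      (not_lt.1 (key h))
    obtain ⟨z, hz⟩ := exists_single_eps_concat hn (Boundary.letter j b' hb')
    have hij : i = j := index_of_mem_cylinder_single ((h _).2 ⟨z, hz.symm⟩)
    subst hbb hij
    rfl
  · exact absurd h (not_sameEnd_letter_concat hn hb hx)

theorem SameEnd.eq_of_finite (hn : 0 < n) (w : List (Letter n)) (i : Bool) (b : Fin n → WithTop ℤ)
    (hx) {y : Boundary n} (h : SameEnd ⟨PreEnd.finite w i b, hx⟩ y) :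
    (⟨PreEnd.finite w i b, hx⟩ : Boundary n) = y := by
  induction w generalizing y with
  | nil => exact SameEnd.eq_of_letter hn hx.2.2 h
  | cons d w ih =>
    have hx' : (PreEnd.finite w i b).IsEnd := ⟨fun a ha => hx.1 a (by simp [ha]),
      (List.isChain_cons.1 hx.2.1).2, hx.2.2⟩
    have hd : d.1 ≠ (PreEnd.finite w i b).index := by
      rcases w with _ | ⟨e, w⟩
      · exact (List.isChain_cons.1 hx.2.1).1 i (by simp)
      · exact (List.isChain_cons.1 hx.2.1).1 e.1 (by simp)
    have heq : (⟨PreEnd.finite (d :: w) i b, hx⟩ : Boundary n) =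
        (Vertex.single d (hx.1 d (by simp))).concat ⟨PreEnd.finite w i b, hx'⟩ := by
      refine Subtype.ext ?_
      rcases w with _ | ⟨e, w⟩ <;> exact (if_neg hd).symm
    rw [heq] at h ⊢
    obtain ⟨y', -, rfl, h'⟩ := SameEnd.concat_single hn (fun h => hd h.symm) h
    rw [ih hx' h']

/-- Finite words are settled by induction on their letters; two infinite words are compared letter
by letter, the relation being inherited by all tails. -/
theorem SameEnd.eq (hn : 0 < n) {x y : Boundary n} (h : SameEnd x y) : x = y := by
  obtain ⟨⟨w, i, b⟩ | u, hx⟩ := x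
  · exact SameEnd.eq_of_finite hn w i b hx h
  obtain ⟨⟨w, i, b⟩ | v, hy⟩ := y
  · exact (SameEnd.eq_of_finite hn w i b hy h.symm).symm
  let s : (u : ℕ → Letter n) → (PreEnd.infinite u).IsEnd → ℕ → Boundary n := fun u hu k =>
    ⟨PreEnd.infinite fun m => u (k + m), fun m => hu.1 _, fun m => hu.2 (k + m)⟩
  have hs : ∀ u hu k, s u hu k = (Vertex.single (u k) (hu.1 k)).concat (s u hu (k + 1)) :=
    fun u hu k => by
      refine Subtype.ext (Eq.trans (congrArg PreEnd.infinite (funext fun m => ?_))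
        (if_neg (hu.2 k)).symm)
      cases m with
      | zero => rfl
      | succ m => exact congrArg u (by omega)
  have step : ∀ k, SameEnd (s u hx k) (s v hy k) →
      u k = v k ∧ SameEnd (s u hx (k + 1)) (s v hy (k + 1)) := fun k h => by
    rw [hs u hx] at h
    obtain ⟨y', hi, h1, h2⟩ := SameEnd.concat_single hn (x := s u hx (k + 1)) (hx.2 k).symm h
    have hi' : (u k).1 = (v k).1 := by
      rw [← index_single_concat _ (hx.1 k) y', ← h1]
      rfl
    have h1' : (s v hy k).1 = y'.1.cons (u k) := congrArg Subtype.val h1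
    have huv : u k = v k := by
      refine Prod.ext hi' (funext fun j => ?_)
      have := (congrArg PreEnd.first h1').trans (PreEnd.first_cons_of_ne fun h => hi h.symm)
      exact (WithTop.coe_injective (congrFun this j)).symm
    refine ⟨huv, ?_⟩
    have h3 : (s v hy k).1.tail = y'.1 :=
      (congrArg PreEnd.tail h1').trans (PreEnd.tail_cons_of_ne fun h => hi h.symm)
    have h4 : s v hy (k + 1) = y' := by
      refine Subtype.ext (Eq.trans (congrArg PreEnd.infinite (funext fun m => ?_)) h3)
      exact congrArg v (by omega)
    rwa [h4]
  have hall : ∀ k, SameEnd (s u hx k) (s v hy k) := fun k => by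
    induction k with
    | zero =>
      have h0 : ∀ u hu, s u hu 0 = ⟨PreEnd.infinite u, hu⟩ := fun u hu =>
        Subtype.ext (congrArg PreEnd.infinite (funext fun m => congrArg u (by omega)))
      rwa [h0, h0]
    | succ k ih => exact (step k ih).2
  exact Subtype.ext (congrArg PreEnd.infinite (funext fun k => (step k (hall k)).1))

/-! ### The topology of the boundary -/

/-- With this topology every `arrow p q` is an open embedding of `∂X` in `𝒢`
(`isOpenEmbedding_arrow`). -/
instance : TopologicalSpace (Boundary n) := TopologicalSpace.generateFrom (basicSets n)

theorem isClopen_cylinder (p : Vertex n) : IsClopen (cylinder p) := by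
  refine ⟨⟨?_⟩, TopologicalSpace.isOpen_generateFrom_of_mem (Or.inl ⟨p, rfl⟩)⟩
  refine TopologicalSpace.isOpen_generateFrom_of_mem (Or.inr ⟨Vertex.root n, p, ?_⟩)
  rw [cylinder_root, Set.compl_eq_univ_sdiff]

/-- Neighbourhoods are generated by the sets `V(p)` and `V(p) \ V(q)`, so agreement on all `V(p)`
with a principal ultrafilter already means convergence. -/
theorem compactSpace_boundary (hn : 0 < n) : CompactSpace (Boundary n) := by
  refine ⟨isCompact_iff_ultrafilter_le_nhds.2 fun U _ => ?_⟩
  obtain ⟨x, hx⟩ := exists_sameCylinders_pure hn U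
  refine ⟨x, Set.mem_univ x, ?_⟩
  rw [TopologicalSpace.nhds_generateFrom]
  refine le_iInf₂ fun A hA => Filter.le_principal_iff.2 ?_
  obtain ⟨hxA, ⟨p, rfl⟩ | ⟨p, q, rfl⟩⟩ := hA
  · exact (hx p).2 hxA
  · refine Filter.inter_mem ((hx p).2 hxA.1) (Ultrafilter.compl_mem_iff_notMem.2 fun h => ?_)
    exact hxA.2 ((hx q).1 h)

theorem exists_isClopen_separating (hn : 0 < n) {x y : Boundary n} (h : x ≠ y) :
    ∃ A : Set (Boundary n), IsClopen A ∧ x ∈ A ∧ y ∉ A := by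
  by_contra hno
  push Not at hno
  refine h (SameEnd.eq hn fun p => ⟨hno _ (isClopen_cylinder p), fun hy => ?_⟩)
  by_contra hx
  exact hno _ (isClopen_cylinder p).compl hx hy

theorem t2Space_boundary (hn : 0 < n) : T2Space (Boundary n) :=
  ⟨fun _ _ h => by
    obtain ⟨A, hA, hx, hy⟩ := exists_isClopen_separating hn h
    exact ⟨A, Aᶜ, hA.2, hA.compl.2, hx, hy, disjoint_compl_right⟩⟩

theorem totallyDisconnectedSpace_boundary (hn : 0 < n) : TotallyDisconnectedSpace (Boundary n) := by
  have : TotallySeparatedSpace (Boundary n) := by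
    rw [totallySeparatedSpace_iff_exists_isClopen]
    exact fun x y h => exists_isClopen_separating hn h
  infer_instance

theorem secondCountableTopology_boundary : SecondCountableTopology (Boundary n) := by
  refine ⟨basicSets n, ?_, rfl⟩
  refine ((Set.countable_range (cylinder (n := n))).union
    (Set.countable_range fun pq : Vertex n × Vertex n => cylinder pq.1 \ cylinder pq.2)).mono ?_
  rintro A (⟨p, rfl⟩ | ⟨p, q, rfl⟩)
  · exact Or.inl ⟨p, rfl⟩
  · exact Or.inr ⟨(p, q), rfl⟩

theorem continuous_concat (p : Vertex n) : Continuous p.concat := by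
  have h : ∀ q : Vertex n, IsClopen (p.concat ⁻¹' cylinder q) := fun q => by
    rcases preimage_cylinder p q with h | h | ⟨t, -, h⟩ <;> rw [h]
    · exact isClopen_univ
    · exact isClopen_empty
    · exact isClopen_cylinder t
  refine continuous_generateFrom_iff.2 fun A hA => ?_
  obtain ⟨q, rfl⟩ | ⟨q, r, rfl⟩ := hA
  · exact (h q).2
  · rw [Set.preimage_sdiff]
    exact ((h q).diff (h r)).2

theorem isOpenEmbedding_concat (p : Vertex n) : Topology.IsOpenEmbedding p.concat := by
  refine ⟨⟨⟨le_antisymm (continuous_concat p).le_induced (le_generateFrom fun A hA => ?_)⟩,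
    concat_injective p⟩, (isClopen_cylinder p).2⟩
  refine ⟨p.concat '' A, ?_, Set.preimage_image_eq _ (concat_injective p)⟩
  obtain ⟨q, rfl⟩ | ⟨q, r, rfl⟩ := hA
  · obtain ⟨s, hs⟩ := exists_isConcat p q
    rw [← hs.cylinder_eq]
    exact (isClopen_cylinder s).2
  · obtain ⟨s, hs⟩ := exists_isConcat p q
    obtain ⟨t, ht⟩ := exists_isConcat p r
    rw [Set.image_sdiff (concat_injective p), ← hs.cylinder_eq, ← ht.cylinder_eq]
    exact ((isClopen_cylinder s).diff (isClopen_cylinder t)).2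

end ZnTree

namespace ZnTree

variable {n : ℕ}

instance [NeZero n] : CompactSpace (Boundary n) := compactSpace_boundary (NeZero.pos n)

instance [NeZero n] : T2Space (Boundary n) := t2Space_boundary (NeZero.pos n)

instance [NeZero n] : TotallyDisconnectedSpace (Boundary n) :=
  totallyDisconnectedSpace_boundary (NeZero.pos n)

instance : SecondCountableTopology (Boundary n) := secondCountableTopology_boundary

/-! ### The topology of the groupoid -/

/-- The arrow `(p x, l(p) - l(q), q x)`. -/
def arrow (p q : Vertex n) (x : Boundary n) : Arrow n :=
  ⟨p.concat x, p.length - q.length, q.concat x, p, q, x, rfl, rfl, rfl⟩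

theorem bisection_eq_image (p q : Vertex n) (A : Set (Boundary n)) :
    bisection p q A = arrow p q '' A := by
  ext a
  constructor
  · rintro ⟨x, hx, h1, h2, h3⟩
    exact ⟨x, hx, Arrow.ext h1.symm h2.symm h3.symm⟩
  · rintro ⟨x, hx, rfl⟩
    exact ⟨x, hx, rfl, rfl, rfl⟩

theorem exists_eq_arrow (a : Arrow n) : ∃ p q x, a = arrow p q x := by
  obtain ⟨p, q, x, h1, h2, h3⟩ := a.shiftEquiv
  exact ⟨p, q, x, Arrow.ext h2 h1 h3⟩

theorem arrow_injective (p q : Vertex n) : Function.Injective (arrow p q) := fun _ _ h =>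
  concat_injective p (congrArg Arrow.range h)

theorem IsConcat.arrow_eq {p q t p' q' : Vertex n} (hp : IsConcat p t p') (hq : IsConcat q t q')
    (x : Boundary n) : arrow p' q' x = arrow p q (t.concat x) :=
  Arrow.ext (hp.1 x) (by simp only [arrow, hp.2, hq.2, add_sub_add_right_eq_sub]) (hq.1 x)

/-- The ranges yield `p' = p t` and the sources `q' = q t'`. Equality of the lags gives `t` and `t'`
the same length, so they act identically. -/
theorem exists_isConcat_of_arrow_eq {p q p' q' : Vertex n} {x x' : Boundary n}
    (h : arrow p q x = arrow p' q' x') (hl : p.length ≤ p'.length) :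
    ∃ t, IsConcat p t p' ∧ IsConcat q t q' ∧ x = t.concat x' := by
  obtain ⟨t, ht, hx⟩ := exists_isConcat_of_concat_eq (congrArg Arrow.range h) hl
  have h2 : p.length - q.length = p'.length - q'.length := congrArg Arrow.lag h
  have hl' : q'.length = q.length + t.length := by
    rw [ht.2, sub_eq_sub_iff_add_eq_add] at h2
    have h3 : p.length + q'.length = p.length + (q.length + t.length) := by
      rw [h2]
      abel
    exact add_left_cancel h3
  obtain ⟨t', ht', hx'⟩ := exists_isConcat_of_concat_eq (congrArg Arrow.source h)
    (by rw [hl']; exact le_add_of_nonneg_right (length_nonneg t))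
  have htt : t.concat = t'.concat := by
    refine (concat_congr (hx.symm.trans hx') ?_).1
    have := ht'.2
    rw [hl'] at this
    exact add_left_cancel this
  exact ⟨t, ht, ⟨fun y => by rw [ht'.1, htt], hl'⟩, hx⟩

/-- Two charts that meet differ by a common right factor `t`, and the transition map is
concatenation with `t`, an open embedding. -/
theorem isOpen_preimage_arrow (p q p' q' : Vertex n) {A : Set (Boundary n)} (hA : IsOpen A) :
    IsOpen (arrow p q ⁻¹' (arrow p' q' '' A)) := by
  rcases (arrow p q ⁻¹' (arrow p' q' '' A)).eq_empty_or_nonempty with h | ⟨x, x', hx', h⟩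
  · rw [h]
    exact isOpen_empty
  rcases le_total p.length p'.length with hl | hl
  · obtain ⟨t, hp, hq, -⟩ := exists_isConcat_of_arrow_eq h.symm hl
    rw [show arrow p' q' '' A = arrow p q '' (t.concat '' A) by
      rw [Set.image_image]
      exact Set.image_congr fun y _ => hp.arrow_eq hq y,
      Set.preimage_image_eq _ (arrow_injective p q)]
    exact (isOpenEmbedding_concat t).isOpenMap A hA
  · obtain ⟨t, hp, hq, -⟩ := exists_isConcat_of_arrow_eq h hl
    rw [show arrow p q = arrow p' q' ∘ t.concat from funext fun y => hp.arrow_eq hq y,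
      Set.preimage_comp, Set.preimage_image_eq _ (arrow_injective p' q')]
    exact (continuous_concat t).isOpen_preimage A hA

theorem isOpen_basicSets {A : Set (Boundary n)} (hA : A ∈ basicSets n) : IsOpen A :=
  TopologicalSpace.isOpen_generateFrom_of_mem hA

theorem continuous_arrow (p q : Vertex n) : Continuous (arrow p q) :=
  continuous_generateFrom_iff.2 fun S ⟨p', q', A, hA, hS⟩ => by
    rw [hS, bisection_eq_image]
    exact isOpen_preimage_arrow p q p' q' (isOpen_basicSets hA)

theorem isOpen_image_arrow_of_mem_basicSets (p q : Vertex n) {A : Set (Boundary n)}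
    (hA : A ∈ basicSets n) : IsOpen (arrow p q '' A) :=
  TopologicalSpace.isOpen_generateFrom_of_mem ⟨p, q, A, hA, (bisection_eq_image p q A).symm⟩

theorem isOpenEmbedding_arrow (p q : Vertex n) : Topology.IsOpenEmbedding (arrow p q) := by
  refine ⟨⟨⟨le_antisymm (continuous_arrow p q).le_induced (le_generateFrom fun A hA => ?_)⟩,
    arrow_injective p q⟩, ?_⟩
  · exact ⟨_, isOpen_image_arrow_of_mem_basicSets p q hA,
      Set.preimage_image_eq _ (arrow_injective p q)⟩
  · rw [← Set.image_univ, ← cylinder_root]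
    exact isOpen_image_arrow_of_mem_basicSets p q (Or.inl ⟨_, rfl⟩)

theorem continuous_range : Continuous (Arrow.range : Arrow n → Boundary n) := by
  refine ⟨fun O hO => isOpen_iff_forall_mem_open.2 fun a ha => ?_⟩
  obtain ⟨p, q, x, rfl⟩ := exists_eq_arrow a
  refine ⟨arrow p q '' (p.concat ⁻¹' O), ?_, (isOpenEmbedding_arrow p q).isOpenMap _
    ((continuous_concat p).isOpen_preimage O hO), ⟨x, ha, rfl⟩⟩
  rintro _ ⟨y, hy, rfl⟩
  exact hy

theorem continuous_source : Continuous (Arrow.source : Arrow n → Boundary n) := by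
  refine ⟨fun O hO => isOpen_iff_forall_mem_open.2 fun a ha => ?_⟩
  obtain ⟨p, q, x, rfl⟩ := exists_eq_arrow a
  refine ⟨arrow p q '' (q.concat ⁻¹' O), ?_, (isOpenEmbedding_arrow p q).isOpenMap _
    ((continuous_concat q).isOpen_preimage O hO), ⟨x, ha, rfl⟩⟩
  rintro _ ⟨y, hy, rfl⟩
  exact hy

instance [NeZero n] : T2Space (Arrow n) := by
  refine T2Space.of_injective_continuous
    (f := fun a : Arrow n => (a.range, a.lag, a.source)) (fun a b h => ?_)
    (continuous_range.prodMk ((continuous_lag n).prodMk continuous_source))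
  simp only [Prod.mk.injEq] at h
  exact Arrow.ext h.1 h.2.1 h.2.2

/-! ### Functions supported on bisections. -/

theorem injOn_range_image_arrow (p q : Vertex n) (S : Set (Boundary n)) :
    Set.InjOn Arrow.range (arrow p q '' S) := by
  rintro _ ⟨x, -, rfl⟩ _ ⟨y, -, rfl⟩ h
  rw [concat_injective p h]

theorem injOn_source_image_arrow (p q : Vertex n) (S : Set (Boundary n)) :
    Set.InjOn Arrow.source (arrow p q '' S) := by
  rintro _ ⟨x, -, rfl⟩ _ ⟨y, -, rfl⟩ h
  rw [concat_injective q h]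

/-- On a bisection each range and source fibre contributes at most one nonzero term, so the `I`-norm
is controlled by the supremum norm. -/
theorem bound_le_of_injOn {f : C_c(Arrow n, ℂ)} {B : Set (Arrow n)} {C : ℝ≥0∞}
    (hr : Set.InjOn Arrow.range B) (hs : Set.InjOn Arrow.source B) (hf : ∀ a, f a ≠ 0 → a ∈ B)
    (hC : ∀ a, ‖f a‖ₑ ≤ C) : (groupoidData n).bound f ≤ C := by
  have key : ∀ g : Arrow n → Boundary n, Set.InjOn g B →
      ⨆ x : Boundary n, ∑' a : {a : Arrow n // g a = x}, ‖f a.1‖ₑ ≤ C := by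
    intro g hg
    refine iSup_le fun x => ?_
    by_cases h : ∃ a : {a : Arrow n // g a = x}, f a.1 ≠ 0
    · obtain ⟨a, ha⟩ := h
      rw [tsum_eq_single a]
      · exact hC a.1
      · intro b hb
        by_contra hb'
        rw [enorm_eq_zero] at hb'
        exact hb (Subtype.ext (hg (hf _ hb') (hf _ ha) (b.2.trans a.2.symm)))
    · push Not at h
      simp [h]
  exact max_le (key _ hr) (key _ hs)

/-- An arrow `c` has at most one factorization `c = a b` with `a ∈ B` and `b ∈ B'`, since `a` is
determined by its range and `b` by its source. -/
theorem isMul_of_indicator {f g h : C_c(Arrow n, ℂ)} {B B' C : Set (Arrow n)}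
    (hf : ∀ a, f a = B.indicator 1 a) (hg : ∀ a, g a = B'.indicator 1 a)
    (hh : ∀ a, h a = C.indicator 1 a) (hB : Set.InjOn Arrow.range B)
    (hB' : Set.InjOn Arrow.source B')
    (hC : ∀ c, c ∈ C ↔ ∃ a ∈ B, ∃ b ∈ B', Arrow.IsProduct a b c) :
    (groupoidData n).IsMul f g h := by
  intro c
  rw [hh]
  have hzero : ∀ ab : {ab : Arrow n × Arrow n // Arrow.IsProduct ab.1 ab.2 c},
      ¬(ab.1.1 ∈ B ∧ ab.1.2 ∈ B') → f ab.1.1 * g ab.1.2 = 0 := by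
    intro ab hab
    rw [hf, hg]
    rcases not_and_or.1 hab with h | h <;> simp [h]
  by_cases hc : c ∈ C
  · obtain ⟨a, ha, b, hb, hab⟩ := (hC c).1 hc
    rw [tsum_eq_single ⟨(a, b), hab⟩, hf, hg]
    · simp [ha, hb, hc]
    · rintro ⟨⟨a', b'⟩, hab'⟩ hne
      refine hzero _ fun ⟨ha', hb'⟩ => hne (Subtype.ext (Prod.ext ?_ ?_))
      · exact hB ha' ha (hab'.2.1.symm.trans hab.2.1)
      · exact hB' hb' hb (hab'.2.2.2.symm.trans hab.2.2.2)
  · rw [Set.indicator_of_notMem hc]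
    refine Eq.symm ((tsum_congr fun ab => hzero ab fun hab => ?_).trans tsum_zero)
    exact hc ((hC c).2 ⟨_, hab.1, _, hab.2, ab.2⟩)

variable [NeZero n]

theorem isCompact_image_arrow (p q : Vertex n) {S : Set (Boundary n)} (hS : IsClopen S) :
    IsCompact (arrow p q '' S) := hS.1.isCompact.image (continuous_arrow p q)

theorem isClopen_image_arrow (p q : Vertex n) {S : Set (Boundary n)} (hS : IsClopen S) :
    IsClopen (arrow p q '' S) :=
  ⟨(isCompact_image_arrow p q hS).isClosed, (isOpenEmbedding_arrow p q).isOpenMap S hS.2⟩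

/-! ### Functions with compact support -/

/-- The characteristic function of `[p, q]_S`. -/
def charFn (p q : Vertex n) (S : TopologicalSpace.Clopens (Boundary n)) : C_c(Arrow n, ℂ) where
  toFun := (arrow p q '' (S : Set (Boundary n))).indicator 1
  continuous_toFun := continuous_one.indicator fun a ha => by
    rw [(isClopen_image_arrow p q S.isClopen).frontier_eq] at ha
    exact ha.elim
  hasCompactSupport' := HasCompactSupport.intro (isCompact_image_arrow p q S.2) fun _ ha =>
    Set.indicator_of_notMem ha _

theorem charFn_apply (p q : Vertex n) (S : TopologicalSpace.Clopens (Boundary n)) (a : Arrow n) :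
    charFn p q S a = (arrow p q '' (S : Set (Boundary n))).indicator 1 a := rfl

theorem charFn_arrow (p q : Vertex n) (S : TopologicalSpace.Clopens (Boundary n)) (x : Boundary n) :
    charFn p q S (arrow p q x) = (S : Set (Boundary n)).indicator 1 x := by
  rw [charFn_apply]
  by_cases hx : x ∈ (S : Set (Boundary n))
  · rw [Set.indicator_of_mem hx, Set.indicator_of_mem (Set.mem_image_of_mem _ hx)]
    rfl
  · rw [Set.indicator_of_notMem hx, Set.indicator_of_notMem]
    rwa [(arrow_injective p q).mem_set_image]

/-- The product of `f` with the characteristic function of a clopen set. -/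
def restrictClopen (f : C_c(Arrow n, ℂ)) (C : Set (Arrow n)) (hC : IsClopen C) :
    C_c(Arrow n, ℂ) where
  toFun := C.indicator f
  continuous_toFun := f.continuous.indicator fun a ha => by
    rw [hC.frontier_eq] at ha
    exact ha.elim
  hasCompactSupport' := f.hasCompactSupport.mono (by simp)

/-- The preimage of a clopen set under the concatenation with `t`. -/
def pullClopen (t : Vertex n) (S : TopologicalSpace.Clopens (Boundary n)) :
    TopologicalSpace.Clopens (Boundary n) :=
  ⟨t.concat ⁻¹' S, S.2.preimage (continuous_concat t)⟩

/-- With `p' = q t` and `r = p t` this is `[p, q]_S [q t, q']_{S'} = [p t, q']_{t⁻¹ S ∩ S'}`. -/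
theorem charFn_isMul {p q p' q' r t : Vertex n} (hp' : IsConcat q t p') (hr : IsConcat p t r)
    (S S' : TopologicalSpace.Clopens (Boundary n)) :
    (groupoidData n).IsMul (charFn p q S) (charFn p' q' S') (charFn r q' (pullClopen t S ⊓ S')) := by
  refine isMul_of_indicator (charFn_apply p q S) (charFn_apply p' q' S') (charFn_apply r q' _)
    (injOn_range_image_arrow _ _ _) (injOn_source_image_arrow _ _ _) fun c => ?_
  have hlag : r.length - q'.length = p.length - q.length + (p'.length - q'.length) := by
    rw [hr.2, hp'.2]
    abel
  constructor
  · rintro ⟨x, ⟨hx, hx'⟩, rfl⟩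
    exact ⟨_, ⟨t.concat x, hx, rfl⟩, _, ⟨x, hx', rfl⟩, (hp'.1 x).symm, hr.1 x, hlag, rfl⟩
  · rintro ⟨_, ⟨x, hx, rfl⟩, _, ⟨x', hx', rfl⟩, h1, h2, h3, h4⟩
    have hxx : x = t.concat x' := concat_injective q (h1.trans (hp'.1 x'))
    refine ⟨x', ⟨?_, hx'⟩, Arrow.ext ?_ ?_ h4.symm⟩
    · rw [hxx] at hx
      exact hx
    · rw [h2, hxx]
      exact hr.1 x'
    · rw [h3]
      exact hlag

theorem charFn_isMul_zero {p q p' q' : Vertex n} (h : ∀ x x', q.concat x ≠ p'.concat x')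
    (S S' : TopologicalSpace.Clopens (Boundary n)) :
    (groupoidData n).IsMul (charFn p q S) (charFn p' q' S') 0 := by
  refine isMul_of_indicator (charFn_apply p q S) (charFn_apply p' q' S') (C := ∅) (fun a => by simp)
    (injOn_range_image_arrow _ _ _) (injOn_source_image_arrow _ _ _) fun c => ?_
  refine iff_of_false (fun h => h) ?_
  rintro ⟨_, ⟨x, hx, rfl⟩, _, ⟨x', hx', rfl⟩, h1, -⟩
  exact h x x' h1

theorem charFn_isStar (p q : Vertex n) (S : TopologicalSpace.Clopens (Boundary n)) :
    (groupoidData n).IsStar (charFn p q S) (charFn q p S) := by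
  intro c
  have h : c.inverse ∈ arrow p q '' (S : Set (Boundary n)) ↔
      c ∈ arrow q p '' (S : Set (Boundary n)) := by
    constructor
    · rintro ⟨x, hx, h⟩
      refine ⟨x, hx, Arrow.ext (congrArg Arrow.source h) ?_ (congrArg Arrow.range h)⟩
      have : p.length - q.length = -c.lag := congrArg Arrow.lag h
      rw [← neg_neg c.lag, ← this, neg_sub]
      rfl
    · rintro ⟨x, hx, rfl⟩
      exact ⟨x, hx, Arrow.ext rfl (neg_sub _ _).symm rfl⟩
  rw [charFn_apply, charFn_apply]
  by_cases hc : c ∈ arrow q p '' (S : Set (Boundary n))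
  · rw [Set.indicator_of_mem hc, Set.indicator_of_mem (h.2 hc)]
    simp
  · rw [Set.indicator_of_notMem hc, Set.indicator_of_notMem (fun h' => hc (h.1 h'))]
    simp

theorem bound_charFn_le (p q : Vertex n) (S : TopologicalSpace.Clopens (Boundary n)) :
    (groupoidData n).bound (charFn p q S) ≤ 1 := by
  refine bound_le_of_injOn (injOn_range_image_arrow p q S) (injOn_source_image_arrow p q S)
    (fun a ha => by_contra fun h => ha (Set.indicator_of_notMem h _)) fun a => ?_
  rw [charFn_apply]
  by_cases ha : a ∈ arrow p q '' (S : Set (Boundary n)) <;> simp [ha]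

end ZnTree

/-! ### Elements of the enveloping C*-algebra -/

namespace Enveloping

variable {V : Type*} [AddCommGroup V] [Module ℂ V] {D : ConvolutionData V}

/-- The inclusion of the enveloping algebra in the algebra of all bounded families. -/
def toFamily : Enveloping D →⋆ₙₐ[ℂ] RepFamily D :=
  NonUnitalStarSubalgebraClass.subtype (envelopingAlgebra D)

theorem toFamily_injective : Function.Injective (toFamily (D := D)) := Subtype.val_injective

theorem norm_toFamily (F : Enveloping D) : ‖toFamily F‖ = ‖F‖ := rfl

theorem isometry_toFamily : Isometry (toFamily (D := D)) := isometry_subtype_coe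

/-- `F` is the image of `f` in the enveloping algebra. -/
def IsImage (F : Enveloping D) (f : V) : Prop := ∀ π : BoundedRep D, toFamily F π = π.toLin f

variable {F G : Enveloping D} {f g h : V}

theorem IsImage.unique (hF : IsImage F f) (hG : IsImage G f) : F = G :=
  toFamily_injective (lp.ext (funext fun π => (hF π).trans (hG π).symm))

theorem IsImage.zero : IsImage (0 : Enveloping D) 0 := fun π => by
  rw [map_zero, map_zero]
  rfl

theorem IsImage.add (hF : IsImage F f) (hG : IsImage G g) : IsImage (F + G) (f + g) := fun π => by
  rw [map_add, map_add, ← hF, ← hG]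
  rfl

theorem IsImage.smul (c : ℂ) (hF : IsImage F f) : IsImage (c • F) (c • f) := fun π => by
  rw [π.toLin.map_smul, ← hF]
  rfl

theorem IsImage.sub (hF : IsImage F f) (hG : IsImage G g) : IsImage (F - G) (f - g) := fun π => by
  rw [map_sub, map_sub, ← hF, ← hG]
  rfl

theorem IsImage.sum {ι : Type*} (s : Finset ι) {F : ι → Enveloping D} {f : ι → V}
    (h : ∀ i, IsImage (F i) (f i)) : IsImage (∑ i ∈ s, F i) (∑ i ∈ s, f i) := by
  classical
  induction s using Finset.induction_on with
  | empty => exact IsImage.zero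
  | insert i s hi ih =>
    rw [Finset.sum_insert hi, Finset.sum_insert hi]
    exact (h i).add ih

theorem IsImage.mul (hF : IsImage F f) (hG : IsImage G g) (hm : D.IsMul f g h) :
    IsImage (F * G) h := fun π => by
  rw [map_mul, π.map_mul f g h hm, ← hF, ← hG]
  rfl

theorem IsImage.star (hF : IsImage F f) (hs : D.IsStar f h) : IsImage (star F) h := fun π => by
  rw [map_star, π.map_star f h hs, ← hF]
  rfl

theorem IsImage.norm_le (hF : IsImage F f) {C : ℝ} (hC : 0 ≤ C)
    (hf : D.bound f ≤ ENNReal.ofReal C) : ‖F‖ ≤ C := by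
  rw [← norm_toFamily]
  refine lp.norm_le_of_forall_le hC fun π => ?_
  rw [hF π, ← ENNReal.ofReal_le_ofReal_iff hC, ofReal_norm]
  exact (π.le_bound f).trans hf

theorem exists_isImage (hf : D.bound f ≠ ∞) : ∃ F : Enveloping D, IsImage F f := by
  have hmem : Memℓp (fun π : BoundedRep D => π.toLin f) ∞ := by
    refine memℓp_infty ⟨(D.bound f).toReal, ?_⟩
    rintro _ ⟨π, rfl⟩
    have := ENNReal.toReal_mono hf (π.le_bound f)
    rwa [toReal_enorm] at this
  refine ⟨⟨⟨_, hmem⟩, NonUnitalStarSubalgebra.le_topologicalClosure _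
    (NonUnitalStarAlgebra.subset_adjoin ℂ _ ⟨f, fun π => rfl⟩)⟩, fun π => rfl⟩

theorem IsImage.extend (φ : D.Endo) (hF : IsImage F f) : IsImage (φ.extend F) (φ.toLin f) :=
  fun π => hF (φ.pullRep π)

-- The enveloping algebra is the smallest closed `*`-subalgebra of the bounded families containing
-- all images. The image of `W` in the families is closed because the inclusion is isometric and
-- `Enveloping D` is complete.
set_option synthInstance.maxHeartbeats 100000 in
theorem mem_of_forall_isImage {W : NonUnitalStarSubalgebra ℂ (Enveloping D)}
    (hW : IsClosed (W : Set (Enveloping D))) (h : ∀ F f, IsImage F f → F ∈ W)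
    (F : Enveloping D) : F ∈ W := by
  have hcl : IsClosed ((W.map toFamily : NonUnitalStarSubalgebra ℂ (RepFamily D)) :
      Set (RepFamily D)) := by
    rw [NonUnitalStarSubalgebra.coe_map]
    exact (isometry_toFamily (D := D)).isClosedEmbedding.isClosedMap _ hW
  have hle : envelopingAlgebra D ≤ W.map toFamily := by
    refine NonUnitalStarSubalgebra.topologicalClosure_minimal _ (NonUnitalStarAlgebra.adjoin_le ?_) hcl
    rintro G ⟨f, hf⟩
    refine ⟨⟨G, NonUnitalStarSubalgebra.le_topologicalClosure _
      (NonUnitalStarAlgebra.subset_adjoin ℂ _ ⟨f, hf⟩)⟩, h _ f hf, rfl⟩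
  obtain ⟨G, hG, hGF⟩ := hle F.2
  rwa [← toFamily_injective hGF]

end Enveloping

/-! ### A criterion for AF algebras -/

/-- A C*-algebra is AF if it is the closed span of countably many elements such that finitely many
of them and their adjoints generate a finite multiplicative semigroup. -/
theorem isAF_of_finite_closure {A : Type*} [NonUnitalCStarAlgebra A] {ι : Type*} [Countable ι]
    [Nonempty ι] (e : ι → A) (hd : Dense (Submodule.span ℂ (Set.range e) : Set A))
    (hstar : ∀ i, star (e i) ∈ Set.range e)
    (hfin : ∀ T : Set A, T.Finite → T ⊆ Set.range e → (Subsemigroup.closure T : Set A).Finite) :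
    IsAF A := by
  obtain ⟨u, hu⟩ := exists_surjective_nat ι
  let T : ℕ → Set A := fun k => (fun m => e (u m)) '' Set.Iio k
  have hT : ∀ k, (T k).Finite := fun k => (Set.finite_Iio k).image _
  refine ⟨fun k => NonUnitalStarAlgebra.adjoin ℂ (T k), fun k m hkm =>
    NonUnitalStarAlgebra.adjoin_mono (Set.image_mono (Set.Iio_subset_Iio hkm)), fun k => ?_, ?_⟩
  · have hf : (Subsemigroup.closure (T k ∪ star (T k)) : Set A).Finite := by
      refine hfin _ ((hT k).union ?_) (Set.union_subset ?_ ?_)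
      · rw [← Set.image_star]
        exact (hT k).image _
      · rintro _ ⟨m, -, rfl⟩
        exact ⟨_, rfl⟩
      · rw [← Set.image_star]
        rintro _ ⟨_, ⟨m, -, rfl⟩, rfl⟩
        exact hstar _
    -- The `*`-algebra generated by `T k` is the linear span of the semigroup generated by `T k` and
    -- its adjoints, which is finite.
    have hspan : (NonUnitalStarAlgebra.adjoin ℂ (T k)).toNonUnitalSubalgebra.toSubmodule =
        Submodule.span ℂ (Subsemigroup.closure (T k ∪ star (T k)) : Set A) := by
      rw [NonUnitalStarAlgebra.adjoin_toNonUnitalSubalgebra, NonUnitalAlgebra.adjoin_eq_span]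
    have : FiniteDimensional ℂ
        (NonUnitalStarAlgebra.adjoin ℂ (T k)).toNonUnitalSubalgebra.toSubmodule := by
      rw [hspan]
      exact FiniteDimensional.span_of_finite ℂ hf
    exact this
  · let S : Submodule ℂ A := ⨆ k, (NonUnitalStarAlgebra.adjoin ℂ (T k)).toNonUnitalSubalgebra.toSubmodule
    refine hd.mono ?_
    have hdir : Directed (· ≤ ·) fun k =>
        (NonUnitalStarAlgebra.adjoin ℂ (T k)).toNonUnitalSubalgebra.toSubmodule :=
      Monotone.directed_le fun k m hkm =>
        NonUnitalStarAlgebra.adjoin_mono (Set.image_mono (Set.Iio_subset_Iio hkm))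
    have hS : (S : Set A) = ⋃ k, (NonUnitalStarAlgebra.adjoin ℂ (T k) : Set A) :=
      Submodule.coe_iSup_of_directed _ hdir
    rw [← hS]
    refine Submodule.span_le.2 ?_
    rintro _ ⟨i, rfl⟩
    obtain ⟨m, rfl⟩ := hu i
    rw [hS]
    exact Set.mem_iUnion.2 ⟨m + 1, NonUnitalStarAlgebra.subset_adjoin ℂ _ ⟨m, Nat.lt_succ_self m, rfl⟩⟩

/-- Elements graded by the levels of a linear order generate finite semigroups if this holds within
each level, and if products of elements have the larger level. -/
theorem finite_closure_of_graded {R L : Type*} [Semigroup R] [LinearOrder L] (E : L → Set R)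
    (hmul : ∀ {i j x y}, i < j → x ∈ E i → y ∈ E j → x * y ∈ E j ∧ y * x ∈ E j)
    (hE : ∀ i x y, x ∈ E i → y ∈ E i → x * y ∈ E i)
    (hfin : ∀ i (T : Set R), T.Finite → T ⊆ E i → (Subsemigroup.closure T : Set R).Finite)
    {T : Set R} (hT : T.Finite) (hTE : T ⊆ ⋃ i, E i) : (Subsemigroup.closure T : Set R).Finite := by
  classical
  -- Levels are added in increasing order. Recording that `T'` stays within the levels of `I`
  -- ensures that the next level, being larger, absorbs products with `T'`.
  have key : ∀ (I : Finset L) (T : Set R), T.Finite → T ⊆ ⋃ i ∈ I, E i →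
      ∃ T' : Subsemigroup R, (T' : Set R).Finite ∧ T ⊆ T' ∧ (T' : Set R) ⊆ ⋃ i ∈ I, E i := by
    intro I
    induction I using Finset.induction_on_max with
    | empty =>
      intro T _ hTE
      exact ⟨⊥, by simp, hTE.trans (by simp), by simp⟩
    | insert m I hm ih =>
      intro T hT hTE
      obtain ⟨T', hT'fin, hTT', hT'E⟩ := ih (T ∩ ⋃ i ∈ I, E i) (hT.inter_of_left _)
        Set.inter_subset_right
      have hl : ∀ x ∈ T', ∀ y ∈ E m, x * y ∈ E m ∧ y * x ∈ E m := fun x hx y hy => by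
        obtain ⟨i, hi, hxi⟩ := Set.mem_iUnion₂.1 (hT'E hx)
        exact hmul (hm i hi) hxi hy
      let F : Set R := T ∩ E m
      have hF : F.Finite := hT.inter_of_left _
      -- `F₂` consists of `F`, `T' F`, `F T'` and `T' F T'`: a finite part of level `m` that is
      -- stable under multiplication by `T'` on both sides.
      let F₁ : Set R := F ∪ Set.image2 (· * ·) T' F
      have hF₁ : F₁.Finite := hF.union (hT'fin.image2 _ hF)
      let F₂ : Set R := F₁ ∪ Set.image2 (· * ·) F₁ T'
      have hF₂ : F₂.Finite := hF₁.union (hF₁.image2 _ hT'fin)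
      have hF₁E : F₁ ⊆ E m := by
        rintro _ (h | ⟨x, hx, y, hy, rfl⟩)
        · exact h.2
        · exact (hl x hx y hy.2).1
      have hF₂E : F₂ ⊆ E m := by
        rintro _ (h | ⟨x, hx, y, hy, rfl⟩)
        · exact hF₁E h
        · exact (hl y hy x (hF₁E hx)).2
      have hl₁ : ∀ x ∈ T', ∀ y ∈ F₁, x * y ∈ F₁ := by
        rintro x hx _ (h | ⟨z, hz, y, hy, rfl⟩)
        · exact Or.inr ⟨x, hx, _, h, rfl⟩
        · exact Or.inr ⟨x * z, T'.mul_mem hx hz, y, hy, mul_assoc _ _ _⟩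
      have hl₂ : ∀ x ∈ T', ∀ y ∈ F₂, x * y ∈ F₂ := by
        rintro x hx _ (h | ⟨y, hy, z, hz, rfl⟩)
        · exact Or.inl (hl₁ x hx _ h)
        · exact Or.inr ⟨x * y, hl₁ x hx y hy, z, hz, mul_assoc _ _ _⟩
      have hr₂ : ∀ x ∈ T', ∀ y ∈ F₂, y * x ∈ F₂ := by
        rintro x hx _ (h | ⟨y, hy, z, hz, rfl⟩)
        · exact Or.inr ⟨_, h, x, hx, rfl⟩
        · exact Or.inr ⟨y, hy, z * x, T'.mul_mem hz hx, (mul_assoc _ _ _).symm⟩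
      let C := Subsemigroup.closure F₂
      have hCE : (C : Set R) ⊆ E m := fun x hx => by
        induction hx using Subsemigroup.closure_induction with
        | mem x h => exact hF₂E h
        | mul x y _ _ h1 h2 => exact hE m x y h1 h2
      have hlC : ∀ x ∈ T', ∀ y ∈ C, x * y ∈ C := fun x hx y hy => by
        induction hy using Subsemigroup.closure_induction with
        | mem y h => exact Subsemigroup.subset_closure (hl₂ x hx y h)
        | mul y z _ hz h1 _ =>
          rw [← mul_assoc]
          exact C.mul_mem h1 hz
      have hrC : ∀ x ∈ T', ∀ y ∈ C, y * x ∈ C := fun x hx y hy => by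
        induction hy using Subsemigroup.closure_induction with
        | mem y h => exact Subsemigroup.subset_closure (hr₂ x hx y h)
        | mul y z hy _ _ h2 =>
          rw [mul_assoc]
          exact C.mul_mem hy h2
      -- Since `T'` multiplies `C` into itself from both sides, `T' ∪ C` is a semigroup; `C` is
      -- finite by the hypothesis on the single level `m`.
      refine ⟨⟨(T' : Set R) ∪ C, ?_⟩, hT'fin.union (hfin m F₂ hF₂ hF₂E), fun x hx => ?_, ?_⟩
      · rintro x y (hx | hx) (hy | hy)
        · exact Or.inl (T'.mul_mem hx hy)
        · exact Or.inr (hlC x hx y hy)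
        · exact Or.inr (hrC y hy x hx)
        · exact Or.inr (C.mul_mem hx hy)
      · obtain ⟨i, hi, hxi⟩ := Set.mem_iUnion₂.1 (hTE hx)
        rcases Finset.mem_insert.1 hi with rfl | hi
        · exact Or.inr (Subsemigroup.subset_closure (Or.inl (Or.inl ⟨hx, hxi⟩)))
        · exact Or.inl (hTT' ⟨hx, Set.mem_iUnion₂.2 ⟨i, hi, hxi⟩⟩)
      · rintro x (hx | hx)
        · obtain ⟨i, hi, hxi⟩ := Set.mem_iUnion₂.1 (hT'E hx)
          exact Set.mem_iUnion₂.2 ⟨i, Finset.mem_insert_of_mem hi, hxi⟩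
        · exact Set.mem_iUnion₂.2 ⟨m, Finset.mem_insert_self m I, hCE hx⟩
  obtain ⟨I, hI⟩ : ∃ I : Finset L, T ⊆ ⋃ i ∈ I, E i := by
    choose f hf using fun x : T => Set.mem_iUnion.1 (hTE x.2)
    have := hT.to_subtype
    refine ⟨(Set.finite_range f).toFinset, fun x hx => Set.mem_iUnion₂.2 ⟨f ⟨x, hx⟩, ?_, hf ⟨x, hx⟩⟩⟩
    simp
  obtain ⟨T', hT', hTT', -⟩ := key I T hT hI
  exact hT'.subset (Subsemigroup.closure_le.2 hTT')

namespace Enveloping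

variable {V : Type*} [AddCommGroup V] [Module ℂ V] {D : ConvolutionData V}

/-- The span of a set closed under products and adjoints is a `*`-subalgebra, so its closure is
everything once it contains the images. -/
theorem dense_span_of_isImage {T : Set (Enveloping D)} (hmul : ∀ x ∈ T, ∀ y ∈ T, x * y ∈ T)
    (hstar : ∀ x ∈ T, star x ∈ T)
    (h : ∀ F f, IsImage F f → F ∈ closure (Submodule.span ℂ T : Set (Enveloping D))) :
    Dense (Submodule.span ℂ T : Set (Enveloping D)) := by
  have hT : T ∪ star T = T := Set.union_eq_left.2 fun x hx => by
    rw [← star_star x]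
    exact hstar _ hx
  have hspan : (NonUnitalStarAlgebra.adjoin ℂ T).toNonUnitalSubalgebra.toSubmodule =
      Submodule.span ℂ T := by
    rw [NonUnitalStarAlgebra.adjoin_toNonUnitalSubalgebra, NonUnitalAlgebra.adjoin_eq_span, hT]
    have hcl : (Subsemigroup.closure T : Set (Enveloping D)) = T :=
      Subsemigroup.closure_eq (⟨T, fun {x y} hx hy => hmul x hx y hy⟩ : Subsemigroup (Enveloping D)) ▸
        rfl
    rw [hcl]
  have hcoe : (NonUnitalStarAlgebra.adjoin ℂ T : Set (Enveloping D)) =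
      (Submodule.span ℂ T : Set (Enveloping D)) := by
    rw [← hspan]
    rfl
  intro F
  rw [← hcoe] at h ⊢
  exact mem_of_forall_isImage (W := (NonUnitalStarAlgebra.adjoin ℂ T).topologicalClosure)
    (NonUnitalStarSubalgebra.isClosed_topologicalClosure _) h F

end Enveloping

namespace ZnTree

open Enveloping TopologicalSpace

variable {n : ℕ} [NeZero n]

/-! ### Generators of the groupoid C*-algebra -/

theorem exists_isImage_charFn (p q : Vertex n) (S : Clopens (Boundary n)) :
    ∃ F : GroupoidCStar n, IsImage F (charFn p q S) :=
  exists_isImage ((bound_charFn_le p q S).trans_lt ENNReal.one_lt_top).ne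

/-- The image of the characteristic function of `[p, q]_S` in `C*(𝒢)`. -/
def chi (p q : Vertex n) (S : Clopens (Boundary n)) : GroupoidCStar n :=
  (exists_isImage_charFn p q S).choose

theorem isImage_chi (p q : Vertex n) (S : Clopens (Boundary n)) :
    IsImage (chi p q S) (charFn p q S) := (exists_isImage_charFn p q S).choose_spec

theorem chi_bot (p q : Vertex n) : chi p q ⊥ = 0 := by
  have h : charFn p q (⊥ : Clopens (Boundary n)) = 0 := by
    ext a
    simp [charFn_apply]
  have := isImage_chi p q ⊥
  rw [h] at this
  exact this.unique IsImage.zero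

theorem star_chi (p q : Vertex n) (S : Clopens (Boundary n)) : star (chi p q S) = chi q p S :=
  ((isImage_chi p q S).star (charFn_isStar p q S)).unique (isImage_chi q p S)

theorem chi_mul {p q p' q' r t : Vertex n} (hp' : IsConcat q t p') (hr : IsConcat p t r)
    (S S' : Clopens (Boundary n)) : chi p q S * chi p' q' S' = chi r q' (pullClopen t S ⊓ S') :=
  ((isImage_chi p q S).mul (isImage_chi p' q' S') (charFn_isMul hp' hr S S')).unique
    (isImage_chi _ _ _)

theorem chi_mul_eq_zero {p q p' q' : Vertex n} (h : ∀ x x', q.concat x ≠ p'.concat x')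
    (S S' : Clopens (Boundary n)) : chi p q S * chi p' q' S' = 0 :=
  ((isImage_chi p q S).mul (isImage_chi p' q' S') (charFn_isMul_zero h S S')).unique IsImage.zero

/-- If `q` and `p'` have a common continuation then `p' = q t`, and the right-hand label `q'`
survives. Otherwise the product is zero, which is written as a generator with empty set. -/
theorem chi_mul_of_le {p q p' q' : Vertex n} (hl : q.length ≤ p'.length)
    (S S' : Clopens (Boundary n)) : ∃ r S'',
      chi p q S * chi p' q' S' = chi r q' S'' := by
  by_cases h : ∃ x x', q.concat x = p'.concat x'
  · obtain ⟨x, x', h⟩ := h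
    obtain ⟨t, ht, -⟩ := exists_isConcat_of_concat_eq h hl
    obtain ⟨r, hr⟩ := exists_isConcat p t
    exact ⟨r, _, chi_mul ht hr S S'⟩
  · push Not at h
    exact ⟨p, ⊥, by rw [chi_mul_eq_zero h, chi_bot]⟩

theorem chi_mul_of_eq {p q p' q' : Vertex n} (hc : q.concat = p'.concat)
    (hl : q.length = p'.length) (S S' : Clopens (Boundary n)) :
    chi p q S * chi p' q' S' = chi p q' (S ⊓ S') :=
  chi_mul (t := Vertex.root n) ⟨fun x => by rw [← hc]; rfl, by simp [hl]⟩ ⟨fun _ => rfl, by simp⟩ S S'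

/-- Words of equal length that act differently have no common continuation. With `chi_mul_of_eq`
these are the relations of matrix units. -/
theorem chi_mul_of_ne {p q p' q' : Vertex n} (hc : q.concat ≠ p'.concat)
    (hl : q.length = p'.length) (S S' : Clopens (Boundary n)) :
    chi p q S * chi p' q' S' = 0 :=
  chi_mul_eq_zero (fun _ _ h => hc (concat_congr h hl).1) S S'

/-- All `chi p q S`. -/
def chiSet (n : ℕ) [NeZero n] : Set (GroupoidCStar n) :=
  {F | ∃ p q S, F = chi p q S}

theorem star_mem_chiSet {F : GroupoidCStar n} (hF : F ∈ chiSet n) : star F ∈ chiSet n := by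
  obtain ⟨p, q, S, rfl⟩ := hF
  exact ⟨q, p, S, star_chi p q S⟩

theorem mul_mem_chiSet {F G : GroupoidCStar n} (hF : F ∈ chiSet n) (hG : G ∈ chiSet n) :
    F * G ∈ chiSet n := by
  obtain ⟨p, q, S, rfl⟩ := hF
  obtain ⟨p', q', S', rfl⟩ := hG
  rcases le_total q.length p'.length with hl | hl
  · obtain ⟨r, S'', h⟩ := chi_mul_of_le hl S S'
    exact ⟨r, q', S'', h⟩
  · obtain ⟨r, S'', h⟩ := chi_mul_of_le (p := q') (q' := p) hl S' S
    refine ⟨p, r, S'', ?_⟩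
    rw [← star_chi r, ← h, star_mul, star_chi, star_chi]

/-! ### Density of the span of the generators -/

/-- In the chart `arrow p q` the function lives on a compact totally disconnected space, where it is
uniformly approximated by combinations of clopen indicators. On a bisection uniform approximation
bounds the `I`-norm, hence the C*-norm. -/
theorem exists_isImage_of_support_subset {f : C_c(Arrow n, ℂ)} {p q : Vertex n}
    (hf : ∀ a, f a ≠ 0 → a ∈ Set.range (arrow p q)) :
    ∃ F ∈ closure (Submodule.span ℂ (chiSet n) : Set (GroupoidCStar n)), IsImage F f := by
  have hbound : ∀ {g : C_c(Arrow n, ℂ)} {C : ℝ}, (∀ a, g a ≠ 0 → a ∈ Set.range (arrow p q)) →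
      (∀ a, ‖g a‖ ≤ C) → (groupoidData n).bound g ≤ ENNReal.ofReal C := fun hg hC => by
    rw [← Set.image_univ] at hg
    refine bound_le_of_injOn (injOn_range_image_arrow p q _) (injOn_source_image_arrow p q _) hg
      fun a => ?_
    rw [← ofReal_norm]
    exact ENNReal.ofReal_le_ofReal (hC a)
  obtain ⟨C, hC⟩ := f.hasCompactSupport.exists_bound_of_continuous f.continuous
  obtain ⟨F, hF⟩ := exists_isImage (D := groupoidData n)
    ((hbound hf hC).trans_lt ENNReal.ofReal_lt_top).ne
  refine ⟨F, Metric.mem_closure_iff.2 fun ε hε => ?_, hF⟩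
  let g : C(Boundary n, ℂ) := ⟨fun x => f (arrow p q x), f.continuous.comp (continuous_arrow p q)⟩
  have hS : {z : ℂ × ℂ | dist z.1 z.2 < ε / 2} ∈ nhdsSet (Set.diagonal ℂ) := by
    refine (isOpen_lt (by fun_prop) continuous_const).mem_nhdsSet.2 ?_
    rintro ⟨z, w⟩ (rfl : z = w)
    simpa using hε
  obtain ⟨m, U, v, h⟩ :=
    g.exists_finite_sum_const_indicator_approximation_of_mem_nhds_diagonal hS
  have hG : IsImage (∑ i, v i • chi p q (U i)) (∑ i, v i • charFn p q (U i)) :=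
    IsImage.sum _ fun i => (isImage_chi p q (U i)).smul (v i)
  have happ : ∀ a, (f - ∑ i, v i • charFn p q (U i)) a =
      f a - ∑ i, v i * charFn p q (U i) a := fun a => by
    rw [CompactlySupportedContinuousMap.sub_apply, CompactlySupportedContinuousMap.sum_apply]
    rfl
  refine ⟨∑ i, v i • chi p q (U i), Submodule.sum_mem _ fun i _ =>
    Submodule.smul_mem _ _ (Submodule.subset_span ⟨p, q, U i, rfl⟩), ?_⟩
  rw [dist_eq_norm]
  refine ((hF.sub hG).norm_le (half_pos hε).le (hbound (fun a ha => ?_) fun a => ?_)).trans_lt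
    (half_lt_self hε)
  · by_contra ha'
    refine ha ?_
    rw [happ, Finset.sum_eq_zero fun i _ => ?_]
    · rw [sub_zero]
      by_contra h0
      exact ha' (hf a h0)
    · rw [charFn_apply, Set.indicator_of_notMem fun h => ha' (Set.image_subset_range _ _ h), mul_zero]
  · by_cases ha : a ∈ Set.range (arrow p q)
    · obtain ⟨x, rfl⟩ := ha
      rw [happ]
      have := h x
      rw [Set.mem_ofPred_eq, dist_eq_norm] at this
      refine le_of_eq_of_le ?_ this.le
      congr 2
      refine Finset.sum_congr rfl fun i _ => ?_
      rw [charFn_arrow]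
      by_cases hx : x ∈ (U i : Set (Boundary n)) <;> simp [hx]
    · have h1 : f a = 0 := by
        by_contra h0
        exact ha (hf a h0)
      rw [happ, h1, Finset.sum_eq_zero fun i _ => ?_]
      · simpa using (half_pos hε).le
      · rw [charFn_apply, Set.indicator_of_notMem fun h => ha (Set.image_subset_range _ _ h), mul_zero]

/-- The charts are clopen, so `f` can be cut along one of them into a part inside and a part covered
by the remaining charts. -/
theorem exists_isImage_of_support_subset_iUnion (s : Finset (Vertex n × Vertex n))
    {f : C_c(Arrow n, ℂ)} (hf : ∀ a, f a ≠ 0 → ∃ pq ∈ s, a ∈ Set.range (arrow pq.1 pq.2)) :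
    ∃ F ∈ closure (Submodule.span ℂ (chiSet n) : Set (GroupoidCStar n)), IsImage F f := by
  classical
  induction s using Finset.induction_on generalizing f with
  | empty =>
    have : f = 0 := by
      ext a
      by_contra ha
      simpa using hf a ha
    subst this
    exact ⟨0, subset_closure (Submodule.zero_mem _), IsImage.zero⟩
  | insert pq s hpq ih =>
    have hC : IsClopen (Set.range (arrow pq.1 pq.2)) := by
      rw [← Set.image_univ]
      exact isClopen_image_arrow _ _ isClopen_univ
    obtain ⟨F, hF, hF'⟩ := exists_isImage_of_support_subset (f := restrictClopen f _ hC)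
      (p := pq.1) (q := pq.2) fun a ha => by
        by_contra h
        exact ha (Set.indicator_of_notMem h _)
    obtain ⟨G, hG, hG'⟩ := ih (f := restrictClopen f _ hC.compl) fun a ha => by
      have h1 : a ∈ (Set.range (arrow pq.1 pq.2))ᶜ := by
        by_contra h
        exact ha (Set.indicator_of_notMem h _)
      have h2 : f a ≠ 0 := by
        intro h
        refine ha ((Set.indicator_of_mem h1 _).trans h)
      obtain ⟨pq', h3, h4⟩ := hf a h2
      rcases Finset.mem_insert.1 h3 with rfl | h3
      · exact absurd h4 h1
      · exact ⟨pq', h3, h4⟩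
    have hsum : f = restrictClopen f _ hC + restrictClopen f _ hC.compl := by
      ext a
      exact (congrFun (Set.indicator_self_add_compl _ f) a).symm
    refine ⟨F + G, ?_, ?_⟩
    · exact (Submodule.span ℂ (chiSet n)).topologicalClosure.add_mem hF hG
    · rw [hsum]
      exact hF'.add hG'

theorem dense_span_chiSet : Dense (Submodule.span ℂ (chiSet n) : Set (GroupoidCStar n)) := by
  refine dense_span_of_isImage (fun _ hx _ hy => mul_mem_chiSet hx hy)
    (fun _ hx => star_mem_chiSet hx) fun F f hF => ?_
  obtain ⟨s, hs⟩ := f.hasCompactSupport.isCompact.elim_finite_subcover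
    (fun pq : Vertex n × Vertex n => Set.range (arrow pq.1 pq.2))
    (fun pq => (isOpenEmbedding_arrow pq.1 pq.2).isOpen_range) fun a _ => by
      obtain ⟨p, q, x, rfl⟩ := exists_eq_arrow a
      exact Set.mem_iUnion.2 ⟨(p, q), x, rfl⟩
  obtain ⟨G, hG, hG'⟩ := exists_isImage_of_support_subset_iUnion s (f := f) fun a ha => by
    simpa using hs (subset_tsupport f ha)
  rwa [hF.unique hG']

end ZnTree

namespace ZnTree

open Enveloping TopologicalSpace MeasureTheory

variable {n : ℕ}

/-! ### Characters of the dual group -/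

/-- The character `t ↦ ⟨k, t⟩`. -/
def character (k : Lam n) : C(DualGroup n, ℂ) where
  toFun t := pairing k t
  continuous_toFun := by
    exact continuous_subtype_val.comp (ContinuousEvalConst.continuous_eval_const (F := Multiplicative (Lam n) →ₜ* Circle)
      (Multiplicative.ofAdd k))

theorem character_apply (k : Lam n) (t : DualGroup n) : character k t = pairing k t := rfl

theorem pairing_mul (k : Lam n) (s t : DualGroup n) :
    pairing k (s * t) = pairing k s * pairing k t := by
  rw [pairing, pairing, pairing, ← Circle.coe_mul]
  rfl

theorem pairing_inv (k : Lam n) (t : DualGroup n) : pairing k t⁻¹ = pairing (-k) t := by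
  rw [pairing, pairing, ofAdd_neg, map_inv]
  rfl

theorem pairing_zero (t : DualGroup n) : pairing (0 : Lam n) t = 1 := by
  simp [pairing]

theorem exists_pairing_ne_one {k : Lam n} (hk : k ≠ 0) : ∃ t : DualGroup n, pairing k t ≠ 1 := by
  obtain ⟨j, hj⟩ : ∃ j, k j ≠ 0 := by
    by_contra h
    push Not at h
    exact hk (funext h)
  -- The character `a ↦ exp(iπ a_j / k_j)` takes the value `-1` at `k`.
  let φ : Multiplicative (Lam n) →* Circle :=
    { toFun := fun a => (Circle.exp (Real.pi / k j)) ^ (Multiplicative.toAdd a j)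
      map_one' := zpow_zero _
      map_mul' := fun a b => zpow_add _ _ _ }
  let t : DualGroup n := (⟨φ, continuous_of_discreteTopology⟩ : Multiplicative (Lam n) →ₜ* Circle)
  refine ⟨t, fun h => ?_⟩
  have h1 : ((Circle.exp (Real.pi / k j) ^ (k j) : Circle) : ℂ) = 1 := h
  rw [Circle.coe_zpow, Circle.coe_exp, ← Complex.exp_int_mul] at h1
  have h2 : (k j : ℂ) * (((Real.pi / k j : ℝ) : ℂ) * Complex.I) = Real.pi * Complex.I := by
    have : (k j : ℂ) ≠ 0 := by exact_mod_cast hj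
    push_cast
    field_simp
  rw [h2, Complex.exp_pi_mul_I] at h1
  norm_num at h1

/-! ### Haar integrals and density of characters. -/

theorem isProbabilityMeasure_normalizedHaar :
    @IsProbabilityMeasure _ (borel (DualGroup n)) (normalizedHaar (DualGroup n)) := by
  let _ := borel (DualGroup n)
  have : BorelSpace (DualGroup n) := ⟨rfl⟩
  exact ⟨Measure.haarMeasure_self⟩

/-- Translation by `s` multiplies the integral by `⟨k, s⟩`; choosing `s` with `⟨k, s⟩ ≠ 1` makes it
vanish. -/
theorem integral_pairing (k : Lam n) :
    @integral (DualGroup n) ℂ _ _ (borel _) (normalizedHaar (DualGroup n)) (fun t => pairing k t) =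
      if k = 0 then 1 else 0 := by
  let _ := borel (DualGroup n)
  have : BorelSpace (DualGroup n) := ⟨rfl⟩
  have := isProbabilityMeasure_normalizedHaar (n := n)
  split_ifs with hk
  · subst hk
    simp [pairing_zero]
  · obtain ⟨s, hs⟩ := exists_pairing_ne_one hk
    have : (normalizedHaar (DualGroup n)).IsMulLeftInvariant :=
      inferInstanceAs (Measure.haarMeasure ⊤).IsMulLeftInvariant
    have h := integral_mul_left_eq_self (μ := normalizedHaar (DualGroup n)) (fun t => pairing k t) s
    simp only [pairing_mul] at h
    rw [integral_const_mul] at h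
    by_contra h0
    exact hs (mul_right_cancel₀ h0 (h.trans (one_mul _).symm))

/-- Stone–Weierstrass: the characters separate points and are closed under products and conjugation,
so their span is dense. -/
theorem mem_of_forall_character_mem (S : Submodule ℂ C(DualGroup n, ℂ))
    (hS : IsClosed (S : Set C(DualGroup n, ℂ)))
    (h : ∀ k, character k ∈ S) (φ : C(DualGroup n, ℂ)) : φ ∈ S := by
  let A : StarSubalgebra ℂ C(DualGroup n, ℂ) := StarAlgebra.adjoin ℂ (Set.range character)
  have hsep : A.SeparatesPoints := by
    intro s t hst
    by_contra hno
    refine hst (PontryaginDual.ext fun a => Circle.coe_injective ?_)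
    by_contra hne
    exact hno ⟨_, ⟨character (Multiplicative.toAdd a),
      StarAlgebra.subset_adjoin ℂ _ ⟨_, rfl⟩, rfl⟩, hne⟩
  have htop := ContinuousMap.starSubalgebra_topologicalClosure_eq_top_of_separatesPoints A hsep
  have hstar : star (Set.range (character (n := n))) = Set.range character := by
    have h : ∀ k : Lam n, star (character k) = character (-k) := fun k =>
      ContinuousMap.ext fun t => (pairing_neg k t).symm
    ext f
    rw [Set.mem_star]
    constructor
    · rintro ⟨k, hk⟩
      exact ⟨-k, by rw [← h, hk, star_star]⟩
    · rintro ⟨k, rfl⟩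
      exact ⟨-k, (h k).symm⟩
  have hA : Subalgebra.toSubmodule A.toSubalgebra ≤ S := by
    rw [StarAlgebra.adjoin_toSubalgebra, hstar, Set.union_self, Algebra.adjoin_eq_span]
    refine Submodule.span_le.2 fun f hf => ?_
    obtain ⟨k, rfl⟩ : f ∈ Set.range (character (n := n)) := by
      induction hf using Submonoid.closure_induction with
      | mem x hx => exact hx
      | one => exact ⟨0, ContinuousMap.ext fun t => pairing_zero t⟩
      | mul x y _ _ hx hy =>
        obtain ⟨k, rfl⟩ := hx
        obtain ⟨m, rfl⟩ := hy
        exact ⟨k + m, ContinuousMap.ext fun t => pairing_add k m t⟩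
    exact h k
  have hφ : φ ∈ A.topologicalClosure := htop ▸ StarSubalgebra.mem_top
  exact closure_minimal hA hS hφ

end ZnTree

/-! ### Functions with values in a normed space -/

section

variable {K E : Type*} [TopologicalSpace K] [NormedAddCommGroup E] [NormedSpace ℂ E]

/-- The function `t ↦ φ t • a`. -/
def smulFn (φ : C(K, ℂ)) (a : E) : C(K, E) := ⟨fun t => φ t • a, by fun_prop⟩

theorem smulFn_apply (φ : C(K, ℂ)) (a : E) (t : K) : smulFn φ a t = φ t • a := rfl

variable [CompactSpace K]

/-- `smulFn` as a continuous linear map in the first variable. -/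
def smulFnLeft (a : E) : C(K, ℂ) →L[ℂ] C(K, E) :=
  LinearMap.mkContinuous
    { toFun := fun φ => smulFn φ a
      map_add' := fun φ ψ => by ext t; exact add_smul _ _ _
      map_smul' := fun c φ => by ext t; exact smul_assoc c (φ t) a } ‖a‖ fun φ => by
    refine (ContinuousMap.norm_le _ (by positivity)).2 fun t => ?_
    refine (norm_smul_le _ _).trans ?_
    rw [mul_comm]
    gcongr
    exact φ.norm_coe_le_norm t

/-- `smulFn` as a continuous linear map in the second variable. -/
def smulFnRight (φ : C(K, ℂ)) : E →L[ℂ] C(K, E) :=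
  LinearMap.mkContinuous
    { toFun := fun a => smulFn φ a
      map_add' := fun a b => by ext t; exact smul_add _ _ _
      map_smul' := fun c a => by ext t; exact smul_comm _ _ _ } ‖φ‖ fun a => by
    refine (ContinuousMap.norm_le _ (by positivity)).2 fun t => ?_
    refine (norm_smul_le _ _).trans ?_
    gcongr
    exact φ.norm_coe_le_norm t

theorem mem_of_forall_smulFn_mem [T2Space K] {Q : Submodule ℂ C(K, E)}
    (hQ : IsClosed (Q : Set C(K, E))) (h : ∀ (φ : C(K, ℂ)) (a : E), smulFn φ a ∈ Q) (f : C(K, E)) :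
    f ∈ Q := by
  refine hQ.closure_subset (Metric.mem_closure_iff.2 fun ε hε => ?_)
  have hU : ∀ s : K, IsOpen {t | dist (f t) (f s) < ε / 2} := fun s =>
    isOpen_lt (by fun_prop) continuous_const
  obtain ⟨F, hF⟩ := isCompact_univ.elim_finite_subcover (fun s : K => {t | dist (f t) (f s) < ε / 2})
    hU fun s _ => Set.mem_iUnion.2 ⟨s, by simpa using hε⟩
  -- With a partition of unity subordinate to sets of small oscillation, `∑ ρ_s f(s)` at `t` is a
  -- convex combination of values within `ε / 2` of `f t`.
  obtain ⟨ρ, hρ⟩ := PartitionOfUnity.exists_isSubordinate isClosed_univ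
    (fun s : F => {t | dist (f t) (f s) < ε / 2}) (fun s => hU s) (by simpa [Set.iUnion_subtype] using hF)
  let ψ : F → C(K, ℂ) := fun s => ⟨fun t => ((ρ s t : ℝ) : ℂ), by fun_prop⟩
  refine ⟨∑ s, smulFn (ψ s) (f s), Q.sum_mem fun s _ => h _ _, ?_⟩
  rw [dist_comm]
  refine lt_of_le_of_lt ((ContinuousMap.dist_le (half_pos hε).le).2 fun t => ?_) (half_lt_self hε)
  have hconv := ρ.finsum_smul_mem_convex (g := fun s _ => f s) (t := Metric.ball (f t) (ε / 2))
    (Set.mem_univ t) (fun s hs => ?_) (convex_ball _ _)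
  · rw [finsum_eq_sum_of_fintype] at hconv
    rw [ContinuousMap.sum_apply]
    refine le_of_lt (lt_of_eq_of_lt ?_ (Metric.mem_ball.1 hconv))
    rfl
  · rw [Metric.mem_ball, dist_comm]
    exact hρ s (subset_tsupport _ hs)

end

namespace ZnTree

open Enveloping TopologicalSpace MeasureTheory

variable {n : ℕ}

/-! ### Generators of the crossed product -/

theorem bound_crossedProductData_le (f : C(DualGroup n, GroupoidCStar n)) :
    (crossedProductData (gaugeAction n)).bound f ≤ ENNReal.ofReal ‖f‖ := by
  let _ := borel (DualGroup n)
  have : BorelSpace (DualGroup n) := ⟨rfl⟩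
  have := isProbabilityMeasure_normalizedHaar (n := n)
  change ∫⁻ t, ‖f t‖ₑ ∂(normalizedHaar (DualGroup n)) ≤ _
  refine (lintegral_mono (g := fun _ => ENNReal.ofReal ‖f‖) fun t => ?_).trans ?_
  · rw [← ofReal_norm]
    exact ENNReal.ofReal_le_ofReal (f.norm_coe_le_norm t)
  · simp

theorem exists_isImage_crossed (f : C(DualGroup n, GroupoidCStar n)) :
    ∃ F : CrossedProduct (gaugeAction n), IsImage F f :=
  exists_isImage ((bound_crossedProductData_le f).trans_lt ENNReal.ofReal_lt_top).ne

/-- The map from `C(Λ̂, A)` to the crossed product. -/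
def toCrossed : C(DualGroup n, GroupoidCStar n) →L[ℂ] CrossedProduct (gaugeAction n) :=
  LinearMap.mkContinuous
    { toFun := fun f => (exists_isImage_crossed f).choose
      map_add' := fun f g => (exists_isImage_crossed (f + g)).choose_spec.unique
        ((exists_isImage_crossed f).choose_spec.add (exists_isImage_crossed g).choose_spec)
      map_smul' := fun c f => (exists_isImage_crossed (c • f)).choose_spec.unique
        ((exists_isImage_crossed f).choose_spec.smul c) } 1 fun f => by
    rw [one_mul]
    exact (exists_isImage_crossed f).choose_spec.norm_le (norm_nonneg f)
      (bound_crossedProductData_le f)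

theorem isImage_toCrossed (f : C(DualGroup n, GroupoidCStar n)) : IsImage (toCrossed f) f :=
  (exists_isImage_crossed f).choose_spec

/-- The image of the function `t ↦ ⟨k, t⟩ a` in the crossed product. -/
def cross (k : Lam n) (a : GroupoidCStar n) : CrossedProduct (gaugeAction n) :=
  toCrossed (smulFn (character k) a)

theorem cross_zero (k : Lam n) : cross k (0 : GroupoidCStar n) = 0 := by
  have : smulFn (character k) (0 : GroupoidCStar n) = 0 := by
    ext t
    exact smul_zero _
  rw [cross, this, map_zero]

/-- Homogeneity of `b` turns the convolution integrand at `s` into `⟨k + m - k', t⟩` times a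
constant, and orthogonality of characters leaves only `k + m = k'`. -/
theorem cross_mul {k k' m : Lam n} {a b : GroupoidCStar n}
    (hb : ∀ t, gaugeAction n t b = pairing m t • b) :
    cross k a * cross k' b = if k + m = k' then cross k' (a * b) else 0 := by
  have hmul : (crossedProductData (gaugeAction n)).IsMul (smulFn (character k) a)
      (smulFn (character k') b)
      ((if k + m = k' then (1 : ℂ) else 0) • smulFn (character k') (a * b)) := by
    intro s
    let _ := borel (DualGroup n)
    have h : ∀ t, smulFn (character k) a t *
        gaugeAction n t (smulFn (character k') b (t⁻¹ * s)) =
        pairing (k + m - k') t • (pairing k' s • (a * b)) := fun t => by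
      rw [smulFn_apply, smulFn_apply, map_smul, hb, character_apply, character_apply, pairing_mul,
        pairing_inv, sub_eq_add_neg, pairing_add, pairing_add, smul_mul_assoc, mul_smul_comm,
        mul_smul_comm, smul_smul, smul_smul, smul_smul]
      congr 1
      ring
    change _ = ∫ t, _ ∂(normalizedHaar (DualGroup n))
    simp only [h]
    rw [integral_smul_const, integral_pairing]
    simp only [sub_eq_zero]
    rfl
  refine (((isImage_toCrossed _).mul (isImage_toCrossed _) hmul)).unique ?_
  split_ifs with h
  · rw [one_smul]
    exact isImage_toCrossed _
  · rw [zero_smul]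
    exact IsImage.zero

theorem star_cross {k m : Lam n} {a : GroupoidCStar n}
    (ha : ∀ t, gaugeAction n t (star a) = pairing m t • star a) :
    star (cross k a) = cross (k + m) (star a) := by
  refine ((isImage_toCrossed _).star fun s => ?_).unique (isImage_toCrossed _)
  rw [smulFn_apply, smulFn_apply, star_smul, map_smul, ha, character_apply, character_apply,
    pairing_inv, ← pairing_neg, neg_neg, smul_smul, pairing_add]

/-! ### The grading of the generators by `Λ`. -/

variable [NeZero n]

theorem gaugeAction_chi (t : DualGroup n) (p q : Vertex n) (S : Clopens (Boundary n)) :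
    gaugeAction n t (chi p q S) = pairing (p.length - q.length) t • chi p q S := by
  have h : (gaugeEndo n t).toLin (charFn p q S) = pairing (p.length - q.length) t • charFn p q S := by
    ext a
    change pairing a.lag t * charFn p q S a = pairing (p.length - q.length) t * charFn p q S a
    rw [charFn_apply]
    by_cases ha : a ∈ arrow p q '' (S : Set (Boundary n))
    · obtain ⟨x, -, rfl⟩ := ha
      rfl
    · rw [Set.indicator_of_notMem ha, mul_zero, mul_zero]
  refine ((isImage_chi p q S).extend (gaugeEndo n t)).unique ?_
  rw [h]
  exact (isImage_chi p q S).smul _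

/-- The image of `t ↦ ⟨μ - l(q), t⟩ 1_{[p, q]_S}` in the crossed product. -/
def gen (μ : Lam n) (p q : Vertex n) (S : Clopens (Boundary n)) : CrossedProduct (gaugeAction n) :=
  cross (μ - q.length) (chi p q S)

theorem gen_bot (μ : Lam n) (p q : Vertex n) : gen μ p q ⊥ = 0 := by
  rw [gen, chi_bot, cross_zero]

theorem star_gen (μ : Lam n) (p q : Vertex n) (S : Clopens (Boundary n)) :
    star (gen μ p q S) = gen μ q p S := by
  rw [gen, star_cross (m := q.length - p.length), star_chi, gen]
  · congr 1
    abel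
  · intro t
    rw [star_chi]
    exact gaugeAction_chi t q p S

/-- The condition `k + m = k'` of `cross_mul`, with `k = μ - l(q)`, `m = l(p') - l(q')` and `k' = μ'
- l(q')`, is `l(p') - l(q) = μ' - μ`. -/
theorem gen_mul (μ μ' : Lam n) (p q p' q' : Vertex n) (S S' : Clopens (Boundary n)) :
    gen μ p q S * gen μ' p' q' S' =
      if p'.length - q.length = μ' - μ then cross (μ' - q'.length) (chi p q S * chi p' q' S')
        else 0 := by
  rw [gen, gen, cross_mul (m := p'.length - q'.length) fun t => gaugeAction_chi t p' q' S']
  refine if_congr ?_ rfl rfl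
  rw [← sub_eq_zero, ← sub_eq_zero (a := p'.length - q.length)]
  refine Eq.congr_left ?_
  abel

/-- The generators with a given `μ`. -/
def genSet (μ : Lam n) : Set (CrossedProduct (gaugeAction n)) := {x | ∃ p q S, x = gen μ p q S}

theorem star_mem_genSet {μ : Lam n} {x : CrossedProduct (gaugeAction n)} (hx : x ∈ genSet μ) :
    star x ∈ genSet μ := by
  obtain ⟨p, q, S, rfl⟩ := hx
  exact ⟨q, p, S, star_gen μ p q S⟩

/-- A nonzero product requires `l(p') - l(q) = μ' - μ ≥ 0`, so `chi_mul_of_le` applies and keeps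
`q'`, hence also the character `μ' - l(q')`. -/
theorem mul_mem_genSet_of_le {μ μ' : Lam n} (h : μ ≤ μ') {x y : CrossedProduct (gaugeAction n)}
    (hx : x ∈ genSet μ) (hy : y ∈ genSet μ') : x * y ∈ genSet μ' := by
  obtain ⟨p, q, S, rfl⟩ := hx
  obtain ⟨p', q', S', rfl⟩ := hy
  rw [gen_mul]
  split_ifs with hl
  · obtain ⟨r, S'', hr⟩ := chi_mul_of_le (p := p) (q' := q')
      (sub_nonneg.1 (hl ▸ sub_nonneg.2 h)) S S'
    exact ⟨r, q', S'', by rw [hr, gen]⟩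
  · exact ⟨p', q', ⊥, (gen_bot _ _ _).symm⟩

theorem mul_mem_genSet_of_ge {μ μ' : Lam n} (h : μ ≤ μ') {x y : CrossedProduct (gaugeAction n)}
    (hx : x ∈ genSet μ) (hy : y ∈ genSet μ') : y * x ∈ genSet μ' := by
  rw [← star_star (y * x), star_mul]
  exact star_mem_genSet (mul_mem_genSet_of_le h (star_mem_genSet hx) (star_mem_genSet hy))

/-- At one level a product is zero or `gen μ p q' (S ⊓ S')`. Thus no new words occur, and the clopen
sets are finite intersections of the given ones. -/
theorem finite_closure_of_subset_genSet (μ : Lam n) (T : Set (CrossedProduct (gaugeAction n)))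
    (hT : T.Finite) (hTE : T ⊆ genSet μ) :
    (Subsemigroup.closure T : Set (CrossedProduct (gaugeAction n))).Finite := by
  -- Labels are chosen for every `x`; those outside `T` are dummies.
  have hTE' : ∀ x : CrossedProduct (gaugeAction n), ∃ (p q : Vertex n) (S : Clopens (Boundary n)),
      x ∈ T → x = gen μ p q S := fun x => by
    by_cases hx : x ∈ T
    · obtain ⟨p, q, S, h⟩ := hTE hx
      exact ⟨p, q, S, fun _ => h⟩
    · exact ⟨Vertex.root n, Vertex.root n, ⊥, fun h => absurd h hx⟩
  choose P₁ P₂ I₁ h using hTE'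
  let P : Set (Vertex n) := P₁ '' T ∪ P₂ '' T
  have hP : P.Finite := (hT.image P₁).union (hT.image P₂)
  let I : Set (Clopens (Boundary n)) := infClosure (I₁ '' T)
  have hI : I.Finite := (hT.image I₁).infClosure
  let Z : Set (CrossedProduct (gaugeAction n)) :=
    insert 0 ((fun x : Vertex n × Vertex n × Clopens (Boundary n) => gen μ x.1 x.2.1 x.2.2) ''
      (P ×ˢ P ×ˢ I))
  have hZ : Z.Finite := ((hP.prod (hP.prod hI)).image _).insert 0
  refine hZ.subset fun x hx => ?_
  induction hx using Subsemigroup.closure_induction with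
  | mem x hx =>
    exact Or.inr ⟨(P₁ x, P₂ x, I₁ x), ⟨Or.inl ⟨x, hx, rfl⟩, Or.inr ⟨x, hx, rfl⟩,
      subset_infClosure ⟨x, hx, rfl⟩⟩, (h x hx).symm⟩
  | mul x y _ _ h1 h2 =>
    rcases h1 with rfl | ⟨⟨p, q, S⟩, ⟨hp, hq, hS⟩, rfl⟩
    · exact Or.inl (zero_mul _)
    rcases h2 with rfl | ⟨⟨p', q', S'⟩, ⟨hp', hq', hS'⟩, rfl⟩
    · exact Or.inl (mul_zero _)
    simp only at hp hq hS hp' hq' hS' ⊢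
    rw [gen_mul, sub_self]
    split_ifs with hl
    · have hl' : q.length = p'.length := (sub_eq_zero.1 hl).symm
      by_cases hc : q.concat = p'.concat
      · rw [chi_mul_of_eq hc hl']
        exact Or.inr ⟨(p, q', S ⊓ S'), ⟨hp, hq', infClosed_infClosure hS hS'⟩, rfl⟩
      · rw [chi_mul_of_ne hc hl', cross_zero]
        exact Or.inl rfl
    · exact Or.inl rfl

/-- Three density statements are combined: the `chi p q S` span `A`, the characters span `C(Λ̂)`,
and the functions `φ • a` span `C(Λ̂, A)`, each up to closure. -/
theorem cross_mem_closure_span {W : Submodule ℂ (CrossedProduct (gaugeAction n))}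
    (hW : IsClosed (W : Set (CrossedProduct (gaugeAction n))))
    (h : ∀ μ p q S, gen μ p q S ∈ W) (f : C(DualGroup n, GroupoidCStar n)) : toCrossed f ∈ W := by
  have hQ : IsClosed ((W.comap toCrossed.toLinearMap : Submodule ℂ _) :
      Set C(DualGroup n, GroupoidCStar n)) := hW.preimage toCrossed.continuous
  have h1 : ∀ (k : Lam n) (a : GroupoidCStar n), smulFn (character k) a ∈
      W.comap toCrossed.toLinearMap := by
    intro k a
    have hcl : IsClosed (((W.comap toCrossed.toLinearMap).comap
        (smulFnRight (character k)).toLinearMap : Submodule ℂ (GroupoidCStar n)) :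
        Set (GroupoidCStar n)) := hQ.preimage (smulFnRight (character k)).continuous
    refine closure_minimal (Submodule.span_le.2 ?_) hcl (dense_span_chiSet a)
    rintro _ ⟨p, q, S, rfl⟩
    -- The level `μ = k + l(q)` is the one for which the character `μ - l(q)` in `gen` equals `k`.
    have := h (k + q.length) p q S
    rw [gen, add_sub_cancel_right] at this
    exact this
  refine mem_of_forall_smulFn_mem hQ (fun φ a => ?_) f
  exact mem_of_forall_character_mem ((W.comap toCrossed.toLinearMap).comap
    (smulFnLeft a).toLinearMap) (hQ.preimage (smulFnLeft a).continuous) (fun k => h1 k a) φ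

theorem isAF_crossedProduct : IsAF (CrossedProduct (gaugeAction n)) := by
  have : Countable (Clopens (Boundary n)) := Clopens.countable_iff_secondCountable.2 inferInstance
  let e : Lam n × Vertex n × Vertex n × Clopens (Boundary n) → CrossedProduct (gaugeAction n) :=
    fun x => gen x.1 x.2.1 x.2.2.1 x.2.2.2
  have he : ∀ {x}, x ∈ Set.range e ↔ ∃ μ, x ∈ genSet μ := by
    intro x
    constructor
    · rintro ⟨⟨μ, p, q, S⟩, rfl⟩
      exact ⟨μ, p, q, S, rfl⟩
    · rintro ⟨μ, p, q, S, rfl⟩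
      exact ⟨(μ, p, q, S), rfl⟩
  have hstar : ∀ x ∈ Set.range e, star x ∈ Set.range e := fun x hx => by
    obtain ⟨μ, hx⟩ := he.1 hx
    exact he.2 ⟨μ, star_mem_genSet hx⟩
  have : Nonempty (Vertex n) := ⟨Vertex.root n⟩
  refine isAF_of_finite_closure e ?_ (fun i => hstar _ ⟨i, rfl⟩) fun T hT hTe => ?_
  · refine dense_span_of_isImage (fun x hx y hy => ?_) hstar fun F f hF => ?_
    · obtain ⟨μ, hx⟩ := he.1 hx
      obtain ⟨μ', hy⟩ := he.1 hy
      rcases le_total μ μ' with h | h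
      · exact he.2 ⟨μ', mul_mem_genSet_of_le h hx hy⟩
      · exact he.2 ⟨μ, mul_mem_genSet_of_ge h hy hx⟩
    · rw [hF.unique (isImage_toCrossed f)]
      refine cross_mem_closure_span (W := (Submodule.span ℂ (Set.range e)).topologicalClosure)
        (Submodule.isClosed_topologicalClosure _) (fun μ p q S => ?_) f
      exact subset_closure (Submodule.subset_span ⟨(μ, p, q, S), rfl⟩)
  · refine finite_closure_of_graded genSet (fun hij hx hy => ?_) (fun μ x y hx hy => ?_)
      finite_closure_of_subset_genSet hT fun x hx => Set.mem_iUnion.2 (he.1 (hTe hx))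
    · exact ⟨mul_mem_genSet_of_le hij.le hx hy, mul_mem_genSet_of_ge hij.le hx hy⟩
    · exact mul_mem_genSet_of_le le_rfl hx hy

end ZnTree

end

theorem mainTheorem3 (n : ℕ) (hn : 2 ≤ n) : IsAF (CrossedProduct (ZnTree.gaugeAction n)) := by
  have : NeZero n := ⟨by omega⟩
  exact ZnTree.isAF_crossedProduct
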